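/- Let $d\ge 1$. Functions $\psi,\Psi$ below are complex-valued and derivatives are weak. A (Lebesgue) measurable function $V\colon\mathbb{R}^d\to\mathbb{R}$ is called *admissible* if $V\psi\in L^2(\mathbb{R}^d)$ for every $\psi\in H^1(\mathbb{R}^d)$; it is extended to $\mathbb{R}^{d+1}=\mathbb{R}^d\times\mathbb{R}$ by $V(x,t)=V(x)$. For $\rho>0$ let $$w(y)=\phi(|y|/\rho)\quad(y\in\mathbb{R}^{d+1}),\qquad \phi(r)=r\exp\Bigl(-\int_0^r\frac{1-e^{-t}}{t}\,dt\Bigr).$$ For $\rho>0$, a measurable $V$ and $\alpha_0,C_0\ge 1$, let $\mathrm{CE}(\rho,V,\alpha_0,C_0)$ denote the following assertion: for all $\alpha\ge\alpha_0$ and all $\Psi\in H^2(\mathbb{R}^{d+1})$ with support in $B_\rho(0)\setminus\{0\}$ (where $B_\rho(0)$ is the open ball), both integrands below are integrable and $$\int_{\mathbb{R}^{d+1}}\alpha\rho^2w^{1-2\alpha}|\nabla\Psi|^2+\alpha^3w^{-1-2\alpha}|\Psi|^2\,dy\;\le\; C_0\,\rho^4\int_{\mathbb{R}^{d+1}}w^{2-2\alpha}|(-\Delta+V)\Psi|^2\,dy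 .$$ **Theorem.** 1. There are constants $\tilde\alpha_0,\tilde C_0\ge1$, depending only on $d$, such that $\mathrm{CE}(\rho,0,\tilde\alpha_0,\tilde C_0)$ holds for every $\rho>0$. 2. Let $V\colon\mathbb{R}^d\to\mathbb{R}$ be admissible. Then: (a) There are $\lambda_1,\lambda_2\ge0$ with $$\|V\psi\|_{L^2(\mathbb{R}^d)}^2\le\lambda_1\|\nabla\psi\|_{L^2(\mathbb{R}^d)}^2+\lambda_2\|\psi\|_{L^2(\mathbb{R}^d)}^2\qquad\text{for all }\psi\in H^1(\mathbb{R}^d).\tag{$*$}$$ (b) For every $\rho>0$ there are constants $\alpha_0,C_0\ge 1$ such that $\mathrm{CE}(\rho,V,\alpha_0,C_0)$ holds. (c) Explicitly: if $\rho>0$, if $\tilde\alpha_0,\tilde C_0\ge1$ are any constants such that $\mathrm{CE}(\rho,0,\tilde\alpha_0,\tilde C_0)$ holds, and if $\lambda_1,\lambda_2\ge0$ are any constants satisfying $(*)$, then $\mathrm{CE}(\rho,V,\alpha_0,C_0)$ holds with $$\alpha_0=\max\bigl\{\tilde\alpha_0,\;8\tilde C_0\lambda_1\rho^2+(4\tilde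 C_0\lambda_2\rho^4)^{1/3}\bigr\},\qquad C_0=4\tilde C_0 .$$ -/

import Mathlib

open MeasureTheory Set
open scoped ContDiff

/-- `HasWeakPartial i f g`: the locally integrable function `g` is the weak partial derivative
`∂ᵢ f` of the locally integrable function `f` on `ℝⁿ`, i.e. `∫ (∂ᵢ η) f = - ∫ η g` for every
test function `η ∈ C_c^∞(ℝⁿ)`. -/
def HasWeakPartial {n : ℕ} (i : Fin n) (f g : EuclideanSpace ℝ (Fin n) → ℂ) : Prop :=
  LocallyIntegrable f volume ∧ LocallyIntegrable g volume ∧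
    ∀ η : EuclideanSpace ℝ (Fin n) → ℝ, ContDiff ℝ ∞ η → HasCompactSupport η →
      ∫ y, (fderiv ℝ η y (EuclideanSpace.single i (1 : ℝ))) • f y = - ∫ y, η y • g y

/-- Membership in the Sobolev space `H^k(ℝⁿ) = W^{k,2}(ℝⁿ)` of complex-valued functions:
`f ∈ L²`, and if `k ≥ 1` then each weak partial derivative of `f` exists and lies in `H^{k-1}`. -/
def MemH {n : ℕ} : ℕ → (EuclideanSpace ℝ (Fin n) → ℂ) → Prop
  | 0, f => MemLp f 2 volume
  | k + 1, f => MemLp f 2 volume ∧ ∀ i : Fin n, ∃ g, HasWeakPartial i f g ∧ MemH k g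

open Classical in
/-- The weak partial derivative `∂ᵢ f` (a representative of its a.e. class); by convention `0` if
it does not exist. -/
noncomputable def weakPartial {n : ℕ} (i : Fin n) (f : EuclideanSpace ℝ (Fin n) → ℂ) :
    EuclideanSpace ℝ (Fin n) → ℂ :=
  if h : ∃ g, HasWeakPartial i f g then h.choose else 0

theorem hasWeakPartial_weakPartial {n : ℕ} {i : Fin n} {f : EuclideanSpace ℝ (Fin n) → ℂ}
    (h : ∃ g, HasWeakPartial i f g) : HasWeakPartial i f (weakPartial i f) := by
  unfold weakPartial
  rw [dif_pos h]
  exact h.choose_spec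

/-- `|∇f(y)|²`, for the weak gradient. -/
noncomputable def weakGradSq {n : ℕ} (f : EuclideanSpace ℝ (Fin n) → ℂ)
    (y : EuclideanSpace ℝ (Fin n)) : ℝ :=
  ∑ i : Fin n, ‖weakPartial i f y‖ ^ 2

/-- `Δf = ∑ᵢ ∂ᵢ∂ᵢ f`, for weak derivatives. -/
noncomputable def weakLaplacian {n : ℕ} (f : EuclideanSpace ℝ (Fin n) → ℂ)
    (y : EuclideanSpace ℝ (Fin n)) : ℂ :=
  ∑ i : Fin n, weakPartial i (weakPartial i f) y

/-- `V : ℝᵈ → ℝ` is admissible: it is (Lebesgue) measurable, and the domain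
`{ψ ∈ L² | Vψ ∈ L²}` of the multiplication operator by `V` contains `H¹(ℝᵈ)`. -/
def Admissible {d : ℕ} (V : EuclideanSpace ℝ (Fin d) → ℝ) : Prop :=
  AEMeasurable V volume ∧
    ∀ ψ : EuclideanSpace ℝ (Fin d) → ℂ, MemH 1 ψ → MemLp (fun x => (V x : ℂ) * ψ x) 2 volume

/-- `‖Vψ‖² ≤ l₁ ‖∇ψ‖² + l₂ ‖ψ‖²` in `L²(ℝᵈ)`, for all `ψ ∈ H¹(ℝᵈ)`. -/
def FormBound {d : ℕ} (V : EuclideanSpace ℝ (Fin d) → ℝ) (l₁ l₂ : ℝ) : Prop :=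
  ∀ ψ : EuclideanSpace ℝ (Fin d) → ℂ, MemH 1 ψ →
    ∫ x, ‖(V x : ℂ) * ψ x‖ ^ 2 ≤ l₁ * (∫ x, weakGradSq ψ x) + l₂ * (∫ x, ‖ψ x‖ ^ 2)

/-- `φ(r) = r exp (- ∫₀ʳ (1 - e⁻ᵗ) / t dt)`. -/
noncomputable def carlemanPhi (r : ℝ) : ℝ :=
  r * Real.exp (- ∫ t in (0 : ℝ)..r, (1 - Real.exp (-t)) / t)

/-- The weight `w(y) = φ(|y| / ρ)` on `ℝⁿ`. -/
noncomputable def carlemanWeight {n : ℕ} (ρ : ℝ) (y : EuclideanSpace ℝ (Fin n)) : ℝ :=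
  carlemanPhi (‖y‖ / ρ)

/-- The extension `V(x, t) = V(x)` of `V : ℝᵈ → ℝ` to `ℝᵈ⁺¹ = ℝᵈ × ℝ`, where `t` is the last
coordinate. -/
def extendPotential {d : ℕ} (V : EuclideanSpace ℝ (Fin d) → ℝ)
    (y : EuclideanSpace ℝ (Fin (d + 1))) : ℝ :=
  V (WithLp.toLp 2 fun i : Fin d => y i.castSucc)

/-- `(-Δ + V) Ψ` on `ℝᵈ⁺¹`. -/
noncomputable def schrodinger {d : ℕ} (V : EuclideanSpace ℝ (Fin d) → ℝ)
    (Ψ : EuclideanSpace ℝ (Fin (d + 1)) → ℂ) (y : EuclideanSpace ℝ (Fin (d + 1))) : ℂ :=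
  - weakLaplacian Ψ y + (extendPotential V y : ℂ) * Ψ y

/-- The Carleman estimate with radius `ρ`, potential `V`, threshold `α₀` and constant `C₀`: for all
`α ≥ α₀` and all `Ψ ∈ H²(ℝᵈ⁺¹)` with support in `B_ρ(0) \ {0}`, both integrands are integrable and
`∫ α ρ² w^{1-2α} |∇Ψ|² + α³ w^{-1-2α} |Ψ|² ≤ C₀ ρ⁴ ∫ w^{2-2α} |(-Δ+V)Ψ|²`.
(An element of `H²` with essential support in `B_ρ(0) \ {0}` has a representative whose topological
support is the essential support.) -/
def CarlemanEstimate {d : ℕ} (ρ : ℝ) (V : EuclideanSpace ℝ (Fin d) → ℝ) (α₀ C₀ : ℝ) : Prop :=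
  ∀ α : ℝ, α₀ ≤ α → ∀ Ψ : EuclideanSpace ℝ (Fin (d + 1)) → ℂ, MemH 2 Ψ →
    tsupport Ψ ⊆ Metric.ball 0 ρ \ {0} →
    Integrable (fun y => α * ρ ^ 2 * carlemanWeight ρ y ^ (1 - 2 * α) * weakGradSq Ψ y
      + α ^ 3 * carlemanWeight ρ y ^ (-1 - 2 * α) * ‖Ψ y‖ ^ 2) volume ∧
    Integrable (fun y => carlemanWeight ρ y ^ (2 - 2 * α) * ‖schrodinger V Ψ y‖ ^ 2) volume ∧
    ∫ y, (α * ρ ^ 2 * carlemanWeight ρ y ^ (1 - 2 * α) * weakGradSq Ψ y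
      + α ^ 3 * carlemanWeight ρ y ^ (-1 - 2 * α) * ‖Ψ y‖ ^ 2)
    ≤ C₀ * ρ ^ 4 * ∫ y, carlemanWeight ρ y ^ (2 - 2 * α) * ‖schrodinger V Ψ y‖ ^ 2

open Filter Topology
open scoped Convolution

/-! For `V = 0` the estimate is a Rellich-type identity. Take a real smooth `f` supported in the
punctured ball of `ℝⁿ` and write `f = w^α v`. Since `φ'(s)/φ(s) = e^{-s}/s`, with `r = |y|`, `σ =
1/ρ` and `q = e^{-σr}` one gets `w^{-α} r² Δf = S + A`, where `S = r²Δv + α²q²v` and `A = 2αq y·∇v +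
αq(n-2-σr)v`. Expanding `(S+A)²/r²`, the cross term `2SA/r²` is the divergence of an explicit
compactly supported field plus `4ασq (y·∇v)²/r + 4σα³q³ v²/r` plus lower-order terms in `v²`. These
gains come from differentiating `q`: they would vanish for the weight `|y|`, and this is why `φ`
bends away from the identity. A small multiple of `∇v·∇v + vΔv`, also part of a divergence, then
yields the gradient term. The resulting inequality is pointwise (`carleman_pointwise_algebra`,
`carleman_pointwise`), and integration removes the divergence (`integral_rellichDivergence`). On the
ball `r/(3ρ) ≤ w ≤ r/ρ`, so the powers of `r` and `w` can be exchanged with constants independent of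
`ρ`. Real and imaginary parts give complex `f`, and mollification gives `H²`: the support is compact
and avoids the origin, so every power of `w` is continuous on a neighbourhood of it.

The bound (a) is the closed graph theorem for multiplication by `V` from `H¹` to `L²`
(`Admissible.continuous_mulOperator`).

For the potential, `w^{2-2α}|VΨ|² = |V (w^{1-α}Ψ)|²`. The bound (a), applied on each slice of
constant last coordinate and integrated, controls this by the gradient of `w^{1-α}Ψ`, hence by the
two terms on the left of the Carleman estimate with smaller powers of `α`
(`integral_weighted_potential_le`). With `|ΔΨ|² ≤ 2|(-Δ+V)Ψ|² + 2|VΨ|²`, the threshold on `α` is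
exactly what makes the potential term at most half of the left-hand side, where it is absorbed
(`absorption_bound`, `CarlemanEstimate.add_potential`). -/

/-- The classical partial derivative `∂ᵢ f`. -/
noncomputable def partialDeriv {n : ℕ} {F : Type*} [NormedAddCommGroup F] [NormedSpace ℝ F]
    (i : Fin n) (f : EuclideanSpace ℝ (Fin n) → F) (y : EuclideanSpace ℝ (Fin n)) : F :=
  fderiv ℝ f y (EuclideanSpace.single i (1 : ℝ))

/-- The classical Laplacian `∑ᵢ ∂ᵢ∂ᵢ f`. -/
noncomputable def coordLaplacian {n : ℕ} {F : Type*} [NormedAddCommGroup F] [NormedSpace ℝ F]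
    (f : EuclideanSpace ℝ (Fin n) → F) (y : EuclideanSpace ℝ (Fin n)) : F :=
  ∑ i : Fin n, partialDeriv i (partialDeriv i f) y

/-! ### Classical partial derivatives and their supports -/

section Classical

variable {n : ℕ} {F : Type*} [NormedAddCommGroup F] [NormedSpace ℝ F]

theorem ContDiff.partialDeriv {f : EuclideanSpace ℝ (Fin n) → F} (hf : ContDiff ℝ ∞ f)
    (i : Fin n) : ContDiff ℝ ∞ (partialDeriv i f) :=
  (hf.fderiv_right (m := ∞) (by simp)).clm_apply contDiff_const

theorem tsupport_partialDeriv_subset (f : EuclideanSpace ℝ (Fin n) → F) (i : Fin n) :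
    tsupport (partialDeriv i f) ⊆ tsupport f :=
  (closure_mono fun y hy => by
    contrapose! hy
    simp only [Function.mem_support, not_not] at hy ⊢
    simp [partialDeriv, hy]).trans (tsupport_fderiv_subset ℝ)

theorem tsupport_coordLaplacian_subset (f : EuclideanSpace ℝ (Fin n) → F) :
    tsupport (coordLaplacian f) ⊆ tsupport f := by
  refine closure_minimal (fun y hy => ?_) (isClosed_tsupport f)
  by_contra h
  refine hy (Finset.sum_eq_zero fun i _ => image_eq_zero_of_notMem_tsupport fun hi => h ?_)
  exact tsupport_partialDeriv_subset f i (tsupport_partialDeriv_subset _ i hi)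

theorem contDiff_coordLaplacian {f : EuclideanSpace ℝ (Fin n) → F} (hf : ContDiff ℝ ∞ f) :
    ContDiff ℝ ∞ (coordLaplacian f) :=
  ContDiff.sum fun i _ => (hf.partialDeriv i).partialDeriv i

/-- Integration by parts against the constant function 1. This is the only form of the divergence
theorem needed. -/
theorem integral_partialDeriv_eq_zero {f : EuclideanSpace ℝ (Fin n) → ℝ} (hf : ContDiff ℝ 1 f)
    (hc : HasCompactSupport f) (i : Fin n) :
    Integrable (partialDeriv i f) ∧ ∫ y, partialDeriv i f y = 0 := by
  have hcont : Continuous (partialDeriv i f) :=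
    (hf.continuous_fderiv (by simp)).clm_apply continuous_const
  have hint : Integrable (partialDeriv i f) :=
    hcont.integrable_of_hasCompactSupport
      (hc.of_isClosed_subset (isClosed_tsupport _) (tsupport_partialDeriv_subset f i))
  refine ⟨hint, ?_⟩
  have h := integral_mul_fderiv_eq_neg_fderiv_mul_of_integrable (μ := volume)
    (f := fun _ : EuclideanSpace ℝ (Fin n) => (1 : ℝ)) (g := f)
    (v := EuclideanSpace.single i (1 : ℝ)) (by simp) (by simp only [one_mul]; exact hint)
    (by simpa using hf.continuous.integrable_of_hasCompactSupport hc) (fun _ _ => by fun_prop)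
    (fun x _ => hf.differentiable (by simp) x)
  simpa [partialDeriv] using h

end Classical

/-! ### Weak derivatives: uniqueness, locality, agreement with classical ones -/

section Weak

variable {n : ℕ} {i : Fin n} {f g g' : EuclideanSpace ℝ (Fin n) → ℂ}

theorem HasWeakPartial.ae_unique (h : HasWeakPartial i f g) (h' : HasWeakPartial i f g') :
    g =ᵐ[volume] g' := by
  refine ae_eq_of_integral_contDiff_smul_eq h.2.1 h'.2.1 fun η hη hc => ?_
  have h1 := h.2.2 η hη hc
  rw [h'.2.2 η hη hc] at h1
  exact (neg_injective h1).symm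

theorem HasWeakPartial.congr {f' : EuclideanSpace ℝ (Fin n) → ℂ} (h : HasWeakPartial i f g)
    (hf : f =ᵐ[volume] f') (hg : g =ᵐ[volume] g') : HasWeakPartial i f' g' := by
  refine ⟨(locallyIntegrable_congr hf).1 h.1, (locallyIntegrable_congr hg).1 h.2.1,
    fun η hη hc => ?_⟩
  rw [← integral_congr_ae (hf.mono fun y hy => congrArg _ hy), h.2.2 η hη hc]
  exact congrArg _ (integral_congr_ae (hg.mono fun y hy => congrArg _ hy))

theorem HasWeakPartial.ae_eq_weakPartial (h : HasWeakPartial i f g) :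
    g =ᵐ[volume] weakPartial i f :=
  h.ae_unique (hasWeakPartial_weakPartial ⟨g, h⟩)

theorem MemH.congr : ∀ {k : ℕ} {f f' : EuclideanSpace ℝ (Fin n) → ℂ}, MemH k f →
    f =ᵐ[volume] f' → MemH k f'
  | 0, _, _, h, hf => MemLp.ae_eq hf h
  | _ + 1, _, _, h, hf => ⟨MemLp.ae_eq hf h.1, fun i =>
      let ⟨g, hg, hk⟩ := h.2 i; ⟨g, hg.congr hf Filter.EventuallyEq.rfl, hk⟩⟩

/-- `MemH` only asserts that some derivative is good, whereas `weakPartial` is an arbitrary choice;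
almost-everywhere uniqueness transfers membership to the chosen representative. -/
theorem MemH.weakPartial {k : ℕ} (h : MemH (k + 1) f) (i : Fin n) :
    HasWeakPartial i f (weakPartial i f) ∧ MemH k (weakPartial i f) := by
  obtain ⟨g, hg, hk⟩ := h.2 i
  exact ⟨hasWeakPartial_weakPartial ⟨g, hg⟩, hk.congr hg.ae_eq_weakPartial⟩

theorem MemH.memLp : ∀ {k : ℕ} {f : EuclideanSpace ℝ (Fin n) → ℂ}, MemH k f → MemLp f 2 volume
  | 0, _, h => h
  | _ + 1, _, h => h.1

/-- Weak differentiation is local: test functions supported in `U` do not see `f`. Used to confine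
the weak derivatives to a compact set containing the support. -/
theorem HasWeakPartial.ae_eq_zero (h : HasWeakPartial i f g) {U : Set (EuclideanSpace ℝ (Fin n))}
    (hU : IsOpen U) (hf : ∀ᵐ y, y ∈ U → f y = 0) : ∀ᵐ y, y ∈ U → g y = 0 := by
  refine hU.ae_eq_zero_of_integral_contDiff_smul_eq_zero (h.2.1.locallyIntegrableOn U)
    fun η hη hc hs => ?_
  rw [← neg_eq_zero, ← h.2.2 η hη hc]
  refine integral_eq_zero_of_ae (hf.mono fun y hy => ?_)
  by_cases hyU : y ∈ U
  · simp [hy hyU]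
  · have h0 : partialDeriv i η y = 0 := image_eq_zero_of_notMem_tsupport fun h' =>
      hyU (hs (tsupport_partialDeriv_subset η i h'))
    change partialDeriv i η y • f y = 0
    rw [h0, zero_smul]

theorem hasWeakPartial_partialDeriv (hf : ContDiff ℝ ∞ f) (i : Fin n) :
    HasWeakPartial i f (partialDeriv i f) := by
  have hcf := hf.continuous
  have hcp := (hf.partialDeriv i).continuous
  refine ⟨hcf.locallyIntegrable, hcp.locallyIntegrable, fun η hη hc => ?_⟩
  have hη' := (hη.partialDeriv i).continuous
  have hc' : HasCompactSupport (partialDeriv i η) :=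
    hc.of_isClosed_subset (isClosed_tsupport _) (tsupport_partialDeriv_subset η i)
  have h := integral_bilinear_fderiv_right_eq_neg_left_of_integrable (μ := volume)
    (B := ContinuousLinearMap.lsmul ℝ ℝ) (f := η) (g := f)
    (v := EuclideanSpace.single i (1 : ℝ))
    ((hη'.smul hcf).integrable_of_hasCompactSupport hc'.smul_right)
    ((hη.continuous.smul hcp).integrable_of_hasCompactSupport hc.smul_right)
    ((hη.continuous.smul hcf).integrable_of_hasCompactSupport hc.smul_right)
    (fun x _ => hη.differentiable (by simp) x) (fun x _ => hf.differentiable (by simp) x)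
  simp only [ContinuousLinearMap.lsmul_apply] at h
  rw [eq_comm, neg_eq_iff_eq_neg]
  exact h

theorem memH_one_of_contDiff (hf : ContDiff ℝ ∞ f) (hc : HasCompactSupport f) : MemH 1 f :=
  ⟨hf.continuous.memLp_of_hasCompactSupport hc, fun i =>
    ⟨_, hasWeakPartial_partialDeriv hf i,
      (hf.partialDeriv i).continuous.memLp_of_hasCompactSupport
        (hc.of_isClosed_subset (isClosed_tsupport _) (tsupport_partialDeriv_subset f i))⟩⟩

theorem weakGradSq_ae_eq_of_contDiff (hf : ContDiff ℝ ∞ f) :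
    weakGradSq f =ᵐ[volume] fun y => ∑ i, ‖partialDeriv i f y‖ ^ 2 := by
  have h : ∀ i, ∀ᵐ y, partialDeriv i f y = weakPartial i f y := fun i =>
    (hasWeakPartial_partialDeriv hf i).ae_eq_weakPartial
  filter_upwards [ae_all_iff.2 h] with y hy
  simp [weakGradSq, hy]

end Weak

/-- Fatou applied to the nonnegative functions `2|u_k|² + 2|f|² - |u_k - f|²`, which tend to
`4|f|²`: with `A = ∫|f|²`, the bound on the norms forces `4A ≤ 4A - limsup ∫|u_k - f|²`. -/
theorem tendsto_integral_norm_sub_sq_of_ae_tendsto {α : Type*} [MeasurableSpace α] {μ : Measure α}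
    {u : ℕ → α → ℂ} {f : α → ℂ} (hu : ∀ k, MemLp (u k) 2 μ) (hf : MemLp f 2 μ)
    (hae : ∀ᵐ x ∂μ, Tendsto (fun k => u k x) atTop (𝓝 (f x)))
    (hle : ∀ k, ∫ x, ‖u k x‖ ^ 2 ∂μ ≤ ∫ x, ‖f x‖ ^ 2 ∂μ) :
    Tendsto (fun k => ∫ x, ‖u k x - f x‖ ^ 2 ∂μ) atTop (𝓝 0) := by
  have hfi := hf.integrable_norm_pow (p := 2) (by simp)
  have hui := fun k => (hu k).integrable_norm_pow (p := 2) (by simp)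
  have hdi := fun k => ((hu k).sub hf).integrable_norm_pow (p := 2) (by simp)
  simp only [Pi.sub_apply] at hdi
  set A := ∫ x, ‖f x‖ ^ 2 ∂μ with hA
  have hpos : ∀ k x, 0 ≤ 2 * ‖u k x‖ ^ 2 + 2 * ‖f x‖ ^ 2 - ‖u k x - f x‖ ^ 2 := fun k x => by
    nlinarith [norm_sub_le (u k x) (f x), norm_nonneg (u k x), norm_nonneg (f x),
      sq_nonneg (‖u k x‖ - ‖f x‖), norm_nonneg (u k x - f x)]
  have hint : ∀ k, ∫ x, (2 * ‖u k x‖ ^ 2 + 2 * ‖f x‖ ^ 2 - ‖u k x - f x‖ ^ 2) ∂μ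
      = 2 * ∫ x, ‖u k x‖ ^ 2 ∂μ + 2 * A - ∫ x, ‖u k x - f x‖ ^ 2 ∂μ := fun k => by
    have h1 : Integrable (fun x => 2 * ‖u k x‖ ^ 2 + 2 * ‖f x‖ ^ 2) μ :=
      ((hui k).const_mul 2).add (hfi.const_mul 2)
    rw [integral_sub h1 (hdi k), integral_add ((hui k).const_mul 2) (hfi.const_mul 2),
      integral_const_mul, integral_const_mul]
  have hqi : ∀ k, Integrable
      (fun x => 2 * ‖u k x‖ ^ 2 + 2 * ‖f x‖ ^ 2 - ‖u k x - f x‖ ^ 2) μ := fun k =>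
    (((hui k).const_mul 2).add (hfi.const_mul 2)).sub (hdi k)
  have hup : ∀ k, ∫ x, (2 * ‖u k x‖ ^ 2 + 2 * ‖f x‖ ^ 2 - ‖u k x - f x‖ ^ 2) ∂μ
      ≤ 4 * A - ∫ x, ‖u k x - f x‖ ^ 2 ∂μ := fun k => by
    rw [hint k]; linarith [hle k]
  have hfatou : ENNReal.ofReal (4 * A) ≤ liminf (fun k => ∫⁻ x, ENNReal.ofReal
      (2 * ‖u k x‖ ^ 2 + 2 * ‖f x‖ ^ 2 - ‖u k x - f x‖ ^ 2) ∂μ) atTop := by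
    have h1 : ENNReal.ofReal (4 * A) = ∫⁻ x, liminf (fun k => ENNReal.ofReal
        (2 * ‖u k x‖ ^ 2 + 2 * ‖f x‖ ^ 2 - ‖u k x - f x‖ ^ 2)) atTop ∂μ := by
      rw [hA, ← integral_const_mul,
        ofReal_integral_eq_lintegral_ofReal (hfi.const_mul 4) (ae_of_all _ fun x => by positivity)]
      refine lintegral_congr_ae (hae.mono fun x hx => ?_)
      refine (Tendsto.liminf_eq (ENNReal.tendsto_ofReal ?_)).symm
      have := ((hx.norm.pow 2).const_mul 2).add_const (2 * ‖f x‖ ^ 2) |>.sub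
        ((hx.sub_const (f x)).norm.pow 2)
      refine this.congr_dist ?_ |>.trans_eq ?_ <;> simp
      ring_nf
    rw [h1]
    exact lintegral_liminf_le' fun k => (hqi k).aestronglyMeasurable.aemeasurable.ennreal_ofReal
  have hd0 : ∀ k, 0 ≤ ∫ x, ‖u k x - f x‖ ^ 2 ∂μ := fun k => integral_nonneg fun x => by positivity
  refine tendsto_order.2 ⟨fun a ha => Eventually.of_forall fun k => ha.trans_le (hd0 k),
    fun δ hδ => ?_⟩
  have hnn : ∀ k, 0 ≤ ∫ x, (2 * ‖u k x‖ ^ 2 + 2 * ‖f x‖ ^ 2 - ‖u k x - f x‖ ^ 2) ∂μ :=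
    fun k => integral_nonneg fun x => hpos k x
  -- In the first case nonnegativity alone gives the bound. In the second, `4A - δ ≥ 0`, so that
  -- `ENNReal.ofReal` does not truncate it and the Fatou inequality can be read back in the reals.
  by_cases hAδ : 4 * A < δ
  · exact Eventually.of_forall fun k => by linarith [hnn k, hup k]
  · have hlt : ENNReal.ofReal (4 * A - δ) < ENNReal.ofReal (4 * A) :=
      (ENNReal.ofReal_lt_ofReal_iff (by linarith)).2 (by linarith)
    filter_upwards [eventually_lt_of_lt_liminf (hlt.trans_le hfatou)] with k hk
    rw [← ofReal_integral_eq_lintegral_ofReal (hqi k) (ae_of_all _ (hpos k)), ENNReal.ofReal_lt_ofReal_iff_of_nonneg (by linarith)]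
      at hk
    have hk' := hk.trans_le (hup k)
    linarith

/-! ### Mollification and smooth approximation in `H²` -/

section Mollify

variable {E : Type*} [NormedAddCommGroup E] [InnerProductSpace ℝ E] [FiniteDimensional ℝ E]
  [MeasurableSpace E] [BorelSpace E]

/-- Cauchy–Schwarz for the probability density `η`, after splitting `η = η^{1/2} η^{1/2}`. -/
theorem enorm_convolution_sq_le {η : E → ℝ} (hη : Continuous η) (h0 : ∀ x, 0 ≤ η x)
    (hi : Integrable η) (h1 : ∫ x, η x = 1) {f : E → ℂ} (hf : AEStronglyMeasurable f volume)
    (x : E) :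
    ‖(η ⋆[ContinuousLinearMap.lsmul ℝ ℝ, volume] f) x‖ₑ ^ 2
      ≤ ∫⁻ t, ENNReal.ofReal (η t) * ‖f (x - t)‖ₑ ^ 2 := by
  have hfx : AEMeasurable (fun t => ‖f (x - t)‖ₑ) volume :=
    (hf.comp_quasiMeasurePreserving (Measure.measurePreserving_sub_left volume
      x).quasiMeasurePreserving).enorm
  have hηm : AEMeasurable (fun t => ENNReal.ofReal (η t)) volume :=
    hη.measurable.ennreal_ofReal.aemeasurable
  have hone : ∫⁻ t, ENNReal.ofReal (η t) = 1 := by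
    rw [← ofReal_integral_eq_lintegral_ofReal hi (ae_of_all _ h0), h1, ENNReal.ofReal_one]
  have hsq : ∀ a : ENNReal, (a ^ (1 / 2 : ℝ)) ^ (2 : ℝ) = a := fun a => by
    rw [← ENNReal.rpow_mul]; norm_num
  have hcs := ENNReal.lintegral_mul_le_Lp_mul_Lq (volume : Measure E)
    (p := 2) (q := 2) (by constructor <;> norm_num)
    (f := fun t => ENNReal.ofReal (η t) ^ (1 / 2 : ℝ))
    (g := fun t => ENNReal.ofReal (η t) ^ (1 / 2 : ℝ) * ‖f (x - t)‖ₑ)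
    (hηm.pow_const _) ((hηm.pow_const _).mul hfx)
  have hl : ‖(η ⋆[ContinuousLinearMap.lsmul ℝ ℝ, volume] f) x‖ₑ
      ≤ ∫⁻ t, ENNReal.ofReal (η t) * ‖f (x - t)‖ₑ := by
    refine (enorm_integral_le_lintegral_enorm _).trans_eq (lintegral_congr fun t => ?_)
    rw [ContinuousLinearMap.lsmul_apply, enorm_smul, Real.enorm_eq_ofReal (h0 t)]
  have hmul : ∀ t, ENNReal.ofReal (η t) ^ (1 / 2 : ℝ)
      * (ENNReal.ofReal (η t) ^ (1 / 2 : ℝ) * ‖f (x - t)‖ₑ)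
      = ENNReal.ofReal (η t) * ‖f (x - t)‖ₑ := fun t => by
    rw [← mul_assoc, ← ENNReal.rpow_add_of_nonneg _ _ (by norm_num) (by norm_num)]; norm_num
  have hg2 : ∀ t, (ENNReal.ofReal (η t) ^ (1 / 2 : ℝ) * ‖f (x - t)‖ₑ) ^ (2 : ℝ)
      = ENNReal.ofReal (η t) * ‖f (x - t)‖ₑ ^ 2 := fun t => by
    rw [ENNReal.mul_rpow_of_nonneg _ _ (by norm_num), hsq]; norm_cast
  simp only [Pi.mul_apply, hmul, hsq, hone, hg2, ENNReal.one_rpow, one_mul] at hcs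
  calc _ ≤ ((∫⁻ t, ENNReal.ofReal (η t) * ‖f (x - t)‖ₑ ^ 2) ^ (1 / 2 : ℝ)) ^ 2 := by
        gcongr; exact hl.trans hcs
    _ = _ := by rw [← ENNReal.rpow_natCast, Nat.cast_ofNat, hsq]

/-- Tonelli and translation invariance turn the pointwise bound into the contraction property of
mollifiers on `L²`. -/
theorem lintegral_enorm_convolution_sq_le {η : E → ℝ} (hη : Continuous η) (h0 : ∀ x, 0 ≤ η x)
    (hi : Integrable η) (h1 : ∫ x, η x = 1) {f : E → ℂ} (hf : AEStronglyMeasurable f volume) :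
    ∫⁻ x, ‖(η ⋆[ContinuousLinearMap.lsmul ℝ ℝ, volume] f) x‖ₑ ^ 2 ≤ ∫⁻ x, ‖f x‖ₑ ^ 2 := by
  refine (lintegral_mono fun x => enorm_convolution_sq_le hη h0 hi h1 hf x).trans ?_
  rw [lintegral_lintegral_swap]
  · have : ∀ t, ∫⁻ x, ENNReal.ofReal (η t) * ‖f (x - t)‖ₑ ^ 2
        = ENNReal.ofReal (η t) * ∫⁻ x, ‖f x‖ₑ ^ 2 := fun t => by
      rw [lintegral_const_mul' _ _ ENNReal.ofReal_ne_top,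
        lintegral_sub_right_eq_self (fun x => ‖f x‖ₑ ^ 2) t]
    simp only [this]
    rw [lintegral_mul_const _ hη.measurable.ennreal_ofReal,
      ← ofReal_integral_eq_lintegral_ofReal hi (ae_of_all _ h0), h1, ENNReal.ofReal_one, one_mul]
  · refine AEMeasurable.mul (hη.measurable.ennreal_ofReal.comp measurable_snd).aemeasurable ?_
    refine AEMeasurable.pow_const ?_ 2
    exact (hf.comp_quasiMeasurePreserving
      (quasiMeasurePreserving_sub_of_right_invariant volume volume)).enorm

theorem integral_norm_sq_eq_toReal {α : Type*} [MeasurableSpace α] {μ : Measure α} {f : α → ℂ}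
    (hf : AEStronglyMeasurable f μ) :
    ∫ x, ‖f x‖ ^ 2 ∂μ = (∫⁻ x, ‖f x‖ₑ ^ 2 ∂μ).toReal := by
  rw [integral_eq_lintegral_of_nonneg_ae (ae_of_all _ fun x => by positivity)
    (by exact hf.norm.pow 2)]
  congr 1
  refine lintegral_congr fun x => ?_
  rw [ENNReal.ofReal_pow (norm_nonneg _), ofReal_norm]

theorem memLp_two_iff_lintegral {α : Type*} [MeasurableSpace α] {μ : Measure α} {f : α → ℂ}
    (hf : AEStronglyMeasurable f μ) : MemLp f 2 μ ↔ ∫⁻ x, ‖f x‖ₑ ^ 2 ∂μ < ⊤ := by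
  rw [MemLp, eLpNorm_lt_top_iff_lintegral_rpow_enorm_lt_top (by simp) (by simp)]
  simp [hf]

theorem memLp_convolution {η : E → ℝ} (hη : Continuous η) (hc : HasCompactSupport η)
    (h0 : ∀ x, 0 ≤ η x) (h1 : ∫ x, η x = 1) {f : E → ℂ} (hf : MemLp f 2 volume) :
    MemLp (η ⋆[ContinuousLinearMap.lsmul ℝ ℝ, volume] f) 2 volume ∧
      ∫ x, ‖(η ⋆[ContinuousLinearMap.lsmul ℝ ℝ, volume] f) x‖ ^ 2 ≤ ∫ x, ‖f x‖ ^ 2 := by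
  have hle := lintegral_enorm_convolution_sq_le hη h0 (hη.integrable_of_hasCompactSupport hc) h1
    hf.aestronglyMeasurable
  have hm : AEStronglyMeasurable (η ⋆[ContinuousLinearMap.lsmul ℝ ℝ, volume] f) volume :=
    (hc.continuous_convolution_left _ hη
      (hf.locallyIntegrable (by norm_num))).aestronglyMeasurable
  have hfin := (memLp_two_iff_lintegral hf.aestronglyMeasurable).1 hf
  refine ⟨(memLp_two_iff_lintegral hm).2 (hle.trans_lt hfin), ?_⟩
  rw [integral_norm_sq_eq_toReal hm, integral_norm_sq_eq_toReal hf.aestronglyMeasurable]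
  exact ENNReal.toReal_mono hfin.ne hle

end Mollify

/-- The definition of the weak derivative is tested with `η(x - ·)`; the sign from the reflection
cancels the one from integration by parts. -/
theorem HasWeakPartial.partialDeriv_convolution {n : ℕ} {i : Fin n}
    {f g : EuclideanSpace ℝ (Fin n) → ℂ} (h : HasWeakPartial i f g)
    {η : EuclideanSpace ℝ (Fin n) → ℝ} (hη : ContDiff ℝ ∞ η) (hc : HasCompactSupport η) :
    partialDeriv i (η ⋆[ContinuousLinearMap.lsmul ℝ ℝ, volume] f)
      = η ⋆[ContinuousLinearMap.lsmul ℝ ℝ, volume] g := by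
  funext x
  have hd := hc.hasFDerivAt_convolution_left (μ := volume) (ContinuousLinearMap.lsmul ℝ ℝ)
    (hη.of_le (by exact_mod_cast le_top)) h.1 x
  rw [partialDeriv, hd.fderiv, convolution_eq_swap, convolution_eq_swap,
    ContinuousLinearMap.integral_apply]
  · have hζ : ContDiff ℝ ∞ fun y => η (x - y) := hη.comp (contDiff_const.sub contDiff_id)
    have hζc : HasCompactSupport fun y => η (x - y) :=
      hc.comp_homeomorph (Homeomorph.subLeft x)
    have hz := h.2.2 _ hζ hζc
    simp only [ContinuousLinearMap.lsmul_apply]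
    rw [eq_comm, ← neg_inj, ← hz, ← integral_neg]
    refine integral_congr_ae (ae_of_all _ fun y => ?_)
    have : HasFDerivAt (fun y => η (x - y)) (-(fderiv ℝ η (x - y))) y := by
      have h1 := (hη.differentiable (by simp) (x - y)).hasFDerivAt.comp y
        ((hasFDerivAt_id y).const_sub x)
      simpa [Function.comp_def] using h1
    simp [this.fderiv, ContinuousLinearMap.precompL_apply]
  · have hex := (hc.fderiv ℝ).convolutionExists_left (μ := volume)
      ((ContinuousLinearMap.lsmul ℝ ℝ).precompL (EuclideanSpace ℝ (Fin n)))
      (hη.continuous_fderiv (by simp)) h.1 x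
    exact hex.integrable_swap

theorem coordLaplacian_convolution {n : ℕ} {f : EuclideanSpace ℝ (Fin n) → ℂ} (hf : MemH 2 f)
    {η : EuclideanSpace ℝ (Fin n) → ℝ} (hη : ContDiff ℝ ∞ η) (hc : HasCompactSupport η) :
    coordLaplacian (η ⋆[ContinuousLinearMap.lsmul ℝ ℝ, volume] f)
      = η ⋆[ContinuousLinearMap.lsmul ℝ ℝ, volume] (weakLaplacian f) := by
  funext x
  have h1 : ∀ i, HasWeakPartial i (weakPartial i f) (weakPartial i (weakPartial i f)) := fun i =>
    ((hf.weakPartial i).2.weakPartial i).1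
  have h2 : ∀ i, partialDeriv i (partialDeriv i (η ⋆[ContinuousLinearMap.lsmul ℝ ℝ, volume] f))
      = η ⋆[ContinuousLinearMap.lsmul ℝ ℝ, volume] (weakPartial i (weakPartial i f)) := fun i => by
    rw [(hf.weakPartial i).1.partialDeriv_convolution hη hc,
      (h1 i).partialDeriv_convolution hη hc]
  simp only [coordLaplacian, h2, convolution_def, weakLaplacian, map_sum]
  rw [integral_finsetSum]
  exact fun i _ => hc.convolutionExists_left _ hη.continuous (h1 i).2.1 x

theorem MemH.memLp_weakLaplacian {n : ℕ} {f : EuclideanSpace ℝ (Fin n) → ℂ} (hf : MemH 2 f) :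
    MemLp (weakLaplacian f) 2 volume :=
  memLp_finsetSum _ fun i _ => ((hf.weakPartial i).2.weakPartial i).2.memLp

theorem tsupport_convolution_subset_cthickening {n : ℕ} {η : EuclideanSpace ℝ (Fin n) → ℝ}
    {f : EuclideanSpace ℝ (Fin n) → ℂ} {δ : ℝ} (hη : Function.support η ⊆ Metric.ball 0 δ) :
    tsupport (η ⋆[ContinuousLinearMap.lsmul ℝ ℝ, volume] f) ⊆ Metric.cthickening δ (tsupport f) := by
  refine closure_minimal (fun x hx => ?_) Metric.isClosed_cthickening
  obtain ⟨a, ha, b, hb, rfl⟩ := support_convolution_subset _ hx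
  refine Metric.mem_cthickening_of_dist_le _ b _ _ (subset_tsupport f hb) ?_
  have := hη ha
  simp only [Metric.mem_ball, dist_zero_right] at this
  simpa [dist_eq_norm] using this.le

/-- All mollifications live in one closed `δ`-thickening of the support, still inside `U`. Each
derivative of the mollification is the mollification of the weak derivative, so one `L²` convergence
statement serves `f`, its gradient and its Laplacian. -/
theorem exists_smooth_approximation {n : ℕ} {f : EuclideanSpace ℝ (Fin n) → ℂ} (hf : MemH 2 f)
    {U : Set (EuclideanSpace ℝ (Fin n))} (hU : IsOpen U) (hc : IsCompact (tsupport f))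
    (hs : tsupport f ⊆ U) :
    ∃ K, IsCompact K ∧ K ⊆ U ∧ tsupport f ⊆ K ∧ ∃ u : ℕ → EuclideanSpace ℝ (Fin n) → ℂ,
      (∀ k, ContDiff ℝ ∞ (u k)) ∧ (∀ k, tsupport (u k) ⊆ K) ∧
      (∀ᵐ x, Tendsto (fun k => u k x) atTop (𝓝 (f x))) ∧
      Tendsto (fun k => ∫ x, ‖u k x - f x‖ ^ 2) atTop (𝓝 0) ∧
      (∀ i, Tendsto (fun k => ∫ x, ‖partialDeriv i (u k) x - weakPartial i f x‖ ^ 2)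
        atTop (𝓝 0)) ∧
      Tendsto (fun k => ∫ x, ‖coordLaplacian (u k) x - weakLaplacian f x‖ ^ 2) atTop (𝓝 0) := by
  obtain ⟨δ, hδ, hδU⟩ := hc.exists_cthickening_subset_open hU hs
  let φ : ℕ → ContDiffBump (0 : EuclideanSpace ℝ (Fin n)) := fun k =>
    -- The bounded ratio of outer to inner radius is what Lebesgue differentiation needs for
    -- almost-everywhere convergence.
    ⟨δ / (k + 1) / 2, δ / (k + 1), by positivity, half_lt_self (by positivity)⟩
  let η : ℕ → EuclideanSpace ℝ (Fin n) → ℝ := fun k => (φ k).normed volume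
  have hφ : Tendsto (fun k => (φ k).rOut) atTop (𝓝 0) := by
    have := (tendsto_one_div_add_atTop_nhds_zero_nat (𝕜 := ℝ)).const_mul δ
    simpa [φ, div_eq_mul_inv] using this
  have hφ' : ∀ᶠ k in atTop, (φ k).rOut ≤ 2 * (φ k).rIn := Eventually.of_forall fun k => by
    simp only [φ]; linarith
  have hηs : ∀ k, ContDiff ℝ ∞ (η k) := fun k => (φ k).contDiff_normed
  have hηc : ∀ k, HasCompactSupport (η k) := fun k => (φ k).hasCompactSupport_normed
  have hL2 : ∀ g : EuclideanSpace ℝ (Fin n) → ℂ, MemLp g 2 volume →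
      Tendsto (fun k => ∫ x, ‖(η k ⋆[ContinuousLinearMap.lsmul ℝ ℝ, volume] g) x - g x‖ ^ 2)
        atTop (𝓝 0) := fun g hg => by
    have h := fun k => memLp_convolution (hηs k).continuous (hηc k) (φ k).nonneg_normed
      (φ k).integral_normed hg
    exact tendsto_integral_norm_sub_sq_of_ae_tendsto (fun k => (h k).1) hg
      (ContDiffBump.ae_convolution_tendsto_right_of_locallyIntegrable hφ hφ'
        (hg.locallyIntegrable (by norm_num))) fun k => (h k).2
  refine ⟨Metric.cthickening δ (tsupport f), hc.cthickening, hδU,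
    Metric.self_subset_cthickening _, fun k => η k ⋆[ContinuousLinearMap.lsmul ℝ ℝ, volume] f,
    fun k => ?_, fun k => ?_, ?_, hL2 f hf.memLp, fun i => ?_, ?_⟩
  · exact (hηc k).contDiff_convolution_left _ (hηs k) (hf.memLp.locallyIntegrable (by norm_num))
  · refine tsupport_convolution_subset_cthickening ?_
    rw [(φ k).support_normed_eq]
    refine Metric.ball_subset_ball ?_
    exact div_le_self hδ.le (by linarith [Nat.cast_nonneg (α := ℝ) k])
  · exact ContDiffBump.ae_convolution_tendsto_right_of_locallyIntegrable hφ hφ'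
      (hf.memLp.locallyIntegrable (by norm_num))
  · simp only [(hf.weakPartial i).1.partialDeriv_convolution (hηs _) (hηc _)]
    exact hL2 _ (hf.weakPartial i).2.memLp
  · simp only [coordLaplacian_convolution hf (hηs _) (hηc _)]
    exact hL2 _ hf.memLp_weakLaplacian

/-- Convergence in `L²` of functions supported in `K` implies convergence of weighted square
norms, for weights that are continuous on the compact set `K`. -/
theorem tendsto_integral_weight_mul_norm_sq {X : Type*} [TopologicalSpace X] [T2Space X]
    [MeasurableSpace X] [BorelSpace X] {μ : Measure X} {K : Set X} (hK : IsCompact K)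
    {W : X → ℝ} (hW : ContinuousOn W K) {u : ℕ → X → ℂ} {f : X → ℂ}
    (hu : ∀ k, MemLp (u k) 2 μ) (hf : MemLp f 2 μ) (huK : ∀ k x, x ∉ K → u k x = 0)
    (hfK : ∀ᵐ x ∂μ, x ∉ K → f x = 0)
    (hlim : Tendsto (fun k => ∫ x, ‖u k x - f x‖ ^ 2 ∂μ) atTop (𝓝 0)) :
    (∀ k, Integrable (fun x => W x * ‖u k x‖ ^ 2) μ) ∧ Integrable (fun x => W x * ‖f x‖ ^ 2) μ ∧
      Tendsto (fun k => ∫ x, W x * ‖u k x‖ ^ 2 ∂μ) atTop (𝓝 (∫ x, W x * ‖f x‖ ^ 2 ∂μ)) := by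
  obtain ⟨M, hM⟩ := hK.exists_bound_of_continuousOn hW
  have hM0 : 0 ≤ max M 0 := le_max_right _ _
  replace hM : ∀ x ∈ K, |W x| ≤ max M 0 := fun x hx => (hM x hx).trans (le_max_left _ _)
  generalize max M 0 = M at hM0 hM
  have hKm := hK.isClosed.measurableSet
  have hfi := hf.integrable_norm_pow (p := 2) (by simp)
  have hui := fun k => (hu k).integrable_norm_pow (p := 2) (by simp)
  have hdi := fun k => ((hu k).sub hf).integrable_norm_pow (p := 2) (by simp)
  simp only [Pi.sub_apply] at hdi
  have hWint : ∀ g : X → ℂ, Integrable (fun x => ‖g x‖ ^ 2) μ → (∀ᵐ x ∂μ, x ∉ K → g x = 0) →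
      Integrable (fun x => W x * ‖g x‖ ^ 2) μ := fun g hg hgK => by
    have hWm : AEStronglyMeasurable (K.indicator W) μ :=
      (hW.aemeasurable hKm |> (aemeasurable_indicator_iff hKm).2).aestronglyMeasurable
    have hb := hg.bdd_mul (c := M) hWm (ae_of_all _ fun x => by
      by_cases hx : x ∈ K
      · simpa [hx] using hM x hx
      · simpa [hx] using hM0)
    refine hb.congr (hgK.mono fun x hx => ?_)
    by_cases hxK : x ∈ K
    · simp [hxK]
    · simp [hx hxK]
  have h1 := fun k => hWint (u k) (hui k) (ae_of_all _ (huK k))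
  have h2 := hWint f hfi hfK
  refine ⟨h1, h2, ?_⟩
  -- Young's inequality in the form `||u|² - |f|²| ≤ (1 + 1/δ)|u - f|² + δ|f|²`. The last term is
  -- made small by choosing `δ`, the first by letting `k` grow.
  have key : ∀ δ : ℝ, 0 < δ → ∀ k, |∫ x, W x * ‖u k x‖ ^ 2 ∂μ - ∫ x, W x * ‖f x‖ ^ 2 ∂μ|
      ≤ M * ((1 + 1 / δ) * ∫ x, ‖u k x - f x‖ ^ 2 ∂μ + δ * ∫ x, ‖f x‖ ^ 2 ∂μ) := by
    intro δ hδ k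
    rw [← integral_sub (h1 k) h2, ← integral_const_mul, ← integral_const_mul,
      ← integral_add ((hdi k).const_mul _) (hfi.const_mul _), ← integral_const_mul]
    refine (abs_integral_le_integral_abs).trans (integral_mono_ae ((h1 k).sub h2).abs
      ((((hdi k).const_mul _).add (hfi.const_mul _)).const_mul _) (hfK.mono fun x hx => ?_))
    simp only [← mul_sub, abs_mul]
    by_cases hxK : x ∈ K
    · refine mul_le_mul (hM x hxK) ?_ (abs_nonneg _) hM0
      have ha : ‖u k x‖ ≤ ‖u k x - f x‖ + ‖f x‖ := by simpa using norm_add_le (u k x - f x) (f x)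
      have hb : ‖f x‖ ≤ ‖u k x - f x‖ + ‖u k x‖ := by
        simpa [norm_sub_rev] using norm_add_le (f x - u k x) (u k x)
      have hd : 2 * (‖u k x - f x‖ * ‖f x‖) ≤ 1 / δ * ‖u k x - f x‖ ^ 2 + δ * ‖f x‖ ^ 2 := by
        have : 0 ≤ 1 / δ * (‖u k x - f x‖ - δ * ‖f x‖) ^ 2 := by positivity
        have e : 1 / δ * (‖u k x - f x‖ - δ * ‖f x‖) ^ 2 = 1 / δ * ‖u k x - f x‖ ^ 2
          - 2 * (‖u k x - f x‖ * ‖f x‖) + δ * ‖f x‖ ^ 2 := by field_simp; ring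
        linarith
      have := norm_nonneg (u k x)
      have := norm_nonneg (f x)
      have := norm_nonneg (u k x - f x)
      rw [abs_le]
      constructor <;> nlinarith
    · simp [huK k x hxK, hx hxK]
  rw [tendsto_iff_dist_tendsto_zero]
  refine tendsto_order.2 ⟨fun a ha => Eventually.of_forall fun k => ha.trans_le dist_nonneg,
    fun ε hε => ?_⟩
  set A := ∫ x, ‖f x‖ ^ 2 ∂μ
  have hA : 0 ≤ A := integral_nonneg fun x => by positivity
  set δ := ε / (2 * (M * A + 1))
  have hδ : 0 < δ := by positivity
  have hδA : M * (δ * A) < ε := by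
    have : δ * (2 * (M * A + 1)) = ε := div_mul_cancel₀ _ (by positivity)
    nlinarith [mul_nonneg hM0 hA, mul_nonneg hδ.le (mul_nonneg hM0 hA)]
  have hlim' := ((hlim.const_mul (1 + 1 / δ)).add_const (δ * A)).const_mul M
  rw [mul_zero, zero_add] at hlim'
  filter_upwards [hlim'.eventually_lt_const hδA] with k hk
  exact (key δ hδ k).trans_lt hk

/-! ### The Carleman weight -/

section Weight

/-- Includes `t = 0`, where division by zero gives the value 0 rather than the limit 1; both lie in
the interval. -/
theorem one_sub_exp_neg_div_mem_Icc {t : ℝ} (ht : 0 ≤ t) :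
    (1 - Real.exp (-t)) / t ∈ Icc (0 : ℝ) 1 := by
  constructor
  · exact div_nonneg (by simpa using ht) ht
  · exact div_le_one_of_le₀ (by linarith [Real.add_one_le_exp (-t)]) ht

theorem measurable_one_sub_exp_neg_div :
    Measurable fun t : ℝ => (1 - Real.exp (-t)) / t := by fun_prop

theorem intervalIntegrable_one_sub_exp_neg_div {s : ℝ} (hs : 0 ≤ s) :
    IntervalIntegrable (fun t => (1 - Real.exp (-t)) / t) volume 0 s := by
  rw [intervalIntegrable_iff, uIoc_of_le hs]
  refine Measure.integrableOn_of_bounded (M := 1) (by simp)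
    measurable_one_sub_exp_neg_div.aestronglyMeasurable ?_
  filter_upwards [ae_restrict_mem measurableSet_Ioc] with t ht
  have := one_sub_exp_neg_div_mem_Icc ht.1.le
  rw [Real.norm_of_nonneg this.1]
  exact this.2

/-- The logarithmic derivative is `1/s - (1 - e^{-s})/s = e^{-s}/s`. This cancellation is the
purpose of the integral in `φ`. -/
theorem hasDerivAt_carlemanPhi {s : ℝ} (hs : 0 < s) :
    HasDerivAt carlemanPhi (carlemanPhi s * Real.exp (-s) / s) s := by
  have hI : HasDerivAt (fun r => ∫ t in (0 : ℝ)..r, (1 - Real.exp (-t)) / t)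
      ((1 - Real.exp (-s)) / s) s :=
    intervalIntegral.integral_hasDerivAt_right (intervalIntegrable_one_sub_exp_neg_div hs.le)
      measurable_one_sub_exp_neg_div.stronglyMeasurable.stronglyMeasurableAtFilter
      (by fun_prop (disch := exact hs.ne'))
  have h := (hasDerivAt_id s).mul hI.neg.exp
  refine h.congr_deriv ?_
  simp only [carlemanPhi, id, Pi.neg_apply]
  generalize Real.exp (-∫ t in (0 : ℝ)..s, (1 - Real.exp (-t)) / t) = z
  field_simp
  ring

theorem carlemanPhi_pos {s : ℝ} (hs : 0 < s) : 0 < carlemanPhi s :=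
  mul_pos hs (Real.exp_pos _)

theorem contDiffOn_carlemanPhi : ContDiffOn ℝ ∞ carlemanPhi (Ioi 0) := by
  have hI : ContDiffOn ℝ ∞ (fun r => ∫ t in (0 : ℝ)..r, (1 - Real.exp (-t)) / t) (Ioi 0) := by
    have hd : ∀ s ∈ Ioi (0 : ℝ), HasDerivAt (fun r => ∫ t in (0 : ℝ)..r, (1 - Real.exp (-t)) / t)
        ((1 - Real.exp (-s)) / s) s := fun s hs =>
      intervalIntegral.integral_hasDerivAt_right
        (intervalIntegrable_one_sub_exp_neg_div (le_of_lt hs))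
        measurable_one_sub_exp_neg_div.stronglyMeasurable.stronglyMeasurableAtFilter
        (by fun_prop (disch := exact (ne_of_gt hs)))
    rw [contDiffOn_infty_iff_deriv_of_isOpen isOpen_Ioi]
    refine ⟨fun s hs => (hd s hs).differentiableAt.differentiableWithinAt, ?_⟩
    refine ContDiffOn.congr (f := fun s => (1 - Real.exp (-s)) / s) ?_ fun s hs => (hd s hs).deriv
    exact ContDiffOn.div (by fun_prop) contDiffOn_id fun s hs => ne_of_gt hs
  exact contDiffOn_id.mul hI.neg.exp

theorem carlemanPhi_le {s : ℝ} (hs : 0 ≤ s) : carlemanPhi s ≤ s := by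
  refine mul_le_of_le_one_right hs (Real.exp_le_one_iff.2 (neg_nonpos.2 ?_))
  exact intervalIntegral.integral_nonneg hs fun t ht => (one_sub_exp_neg_div_mem_Icc ht.1).1

theorem mul_exp_neg_le_carlemanPhi {s : ℝ} (hs : 0 ≤ s) : s * Real.exp (-s) ≤ carlemanPhi s := by
  refine mul_le_mul_of_nonneg_left (Real.exp_le_exp.2 (neg_le_neg ?_)) hs
  have h := intervalIntegral.integral_mono_on hs (intervalIntegrable_one_sub_exp_neg_div hs)
    (intervalIntegrable_const (c := (1 : ℝ)))
    fun t ht => (one_sub_exp_neg_div_mem_Icc ht.1).2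
  simpa using h

theorem one_third_le_exp_neg {s : ℝ} (hs : s ≤ 1) : 1 / 3 ≤ Real.exp (-s) := by
  have h1 : Real.exp s ≤ 3 := (Real.exp_le_exp.2 hs).trans (by linarith [Real.exp_one_lt_d9])
  rw [Real.exp_neg, one_div]
  exact inv_anti₀ (Real.exp_pos s) h1

variable {n : ℕ} {ρ : ℝ}

theorem carlemanWeight_pos (hρ : 0 < ρ) {y : EuclideanSpace ℝ (Fin n)} (hy : y ≠ 0) :
    0 < carlemanWeight ρ y :=
  carlemanPhi_pos (div_pos (norm_pos_iff.2 hy) hρ)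

theorem carlemanWeight_le (hρ : 0 < ρ) (y : EuclideanSpace ℝ (Fin n)) :
    carlemanWeight ρ y ≤ ‖y‖ / ρ :=
  carlemanPhi_le (by positivity)

/-- For `s = |y|/ρ ≤ 1` one has `φ(s) ≥ s e^{-s} ≥ s/3`, since `e ≤ 3`. With `carlemanWeight_le`
this makes `w` and `|y|/ρ` comparable on the ball. -/
theorem norm_div_le_carlemanWeight (hρ : 0 < ρ) {y : EuclideanSpace ℝ (Fin n)} (hy : ‖y‖ ≤ ρ) :
    ‖y‖ / ρ ≤ 3 * carlemanWeight ρ y := by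
  have h1 := mul_exp_neg_le_carlemanPhi (s := ‖y‖ / ρ) (by positivity)
  have h2 := one_third_le_exp_neg (s := ‖y‖ / ρ) (div_le_one_of_le₀ hy hρ.le)
  have h3 : 0 ≤ ‖y‖ / ρ := by positivity
  rw [carlemanWeight]
  nlinarith

theorem contDiffAt_carlemanWeight (hρ : 0 < ρ) {y : EuclideanSpace ℝ (Fin n)} (hy : y ≠ 0) :
    ContDiffAt ℝ ∞ (carlemanWeight ρ) y := by
  have hs : 0 < ‖y‖ / ρ := div_pos (norm_pos_iff.2 hy) hρ
  exact (contDiffOn_carlemanPhi.contDiffAt (Ioi_mem_nhds hs)).comp y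
    ((contDiffAt_norm ℝ hy).div_const ρ)

theorem contDiffAt_carlemanWeight_rpow (hρ : 0 < ρ) (p : ℝ) {y : EuclideanSpace ℝ (Fin n)}
    (hy : y ≠ 0) : ContDiffAt ℝ ∞ (fun y => carlemanWeight ρ y ^ p) y :=
  (contDiffAt_carlemanWeight hρ hy).rpow_const_of_ne (carlemanWeight_pos hρ hy).ne'

theorem hasDerivAt_carlemanPhi_div_rpow (hρ : 0 < ρ) (p : ℝ) {r : ℝ} (hr : 0 < r) :
    HasDerivAt (fun r => carlemanPhi (r / ρ) ^ p)
      (p * Real.exp (-(r / ρ)) / r * carlemanPhi (r / ρ) ^ p) r := by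
  have hs : 0 < r / ρ := div_pos hr hρ
  have hφ := carlemanPhi_pos hs
  have h := ((hasDerivAt_carlemanPhi hs).comp r ((hasDerivAt_id r).div_const ρ)).rpow_const
    (p := p) (Or.inl (by simpa using hφ.ne'))
  refine h.congr_deriv ?_
  simp only [Function.comp, id]
  rw [Real.rpow_sub_one hφ.ne']
  field_simp

end Weight

/-! ### Differentiation rules and radial functions -/

section Radial

variable {n : ℕ}

theorem hasFDerivAt_euclidean_norm {y : EuclideanSpace ℝ (Fin n)} (hy : y ≠ 0) :
    HasFDerivAt (fun y : EuclideanSpace ℝ (Fin n) => ‖y‖) (‖y‖⁻¹ • innerSL ℝ y) y := by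
  have h := (hasStrictFDerivAt_norm_sq y).hasFDerivAt.sqrt (by simpa using hy)
  simp only [Real.sqrt_sq (norm_nonneg _)] at h
  refine h.congr_fderiv ?_
  rw [← Nat.cast_smul_eq_nsmul ℝ, smul_smul]
  congr 1
  have := norm_ne_zero_iff.2 hy
  field_simp
  norm_num

theorem partialDeriv_radial {γ : ℝ → ℝ} {γ' : ℝ} {y : EuclideanSpace ℝ (Fin n)} (hy : y ≠ 0)
    (hγ : HasDerivAt γ γ' ‖y‖) (i : Fin n) :
    DifferentiableAt ℝ (fun y : EuclideanSpace ℝ (Fin n) => γ ‖y‖) y ∧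
      partialDeriv i (fun y : EuclideanSpace ℝ (Fin n) => γ ‖y‖) y = γ' / ‖y‖ * y i := by
  have h := hγ.hasFDerivAt.comp y (hasFDerivAt_euclidean_norm hy)
  refine ⟨h.differentiableAt, ?_⟩
  rw [partialDeriv, show (fun y : EuclideanSpace ℝ (Fin n) => γ ‖y‖) = γ ∘ fun y => ‖y‖ from rfl,
    h.fderiv]
  simp [EuclideanSpace.inner_single_right]
  ring

variable {f g : EuclideanSpace ℝ (Fin n) → ℝ} {y : EuclideanSpace ℝ (Fin n)} {i : Fin n}

theorem partialDeriv_mul (hf : DifferentiableAt ℝ f y) (hg : DifferentiableAt ℝ g y) :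
    partialDeriv i (fun y => f y * g y) y = partialDeriv i f y * g y + f y * partialDeriv i g y := by
  simp only [partialDeriv]
  rw [fderiv_fun_mul hf hg]
  simp
  ring

theorem partialDeriv_add (hf : DifferentiableAt ℝ f y) (hg : DifferentiableAt ℝ g y) :
    partialDeriv i (fun y => f y + g y) y = partialDeriv i f y + partialDeriv i g y := by
  simp only [partialDeriv]
  rw [fderiv_fun_add hf hg]
  simp

theorem partialDeriv_const_mul (c : ℝ) (hf : DifferentiableAt ℝ f y) :
    partialDeriv i (fun y => c * f y) y = c * partialDeriv i f y := by
  simp only [partialDeriv]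
  rw [fderiv_const_mul hf]
  simp

theorem partialDeriv_sum {ι : Type*} {s : Finset ι} {f : ι → EuclideanSpace ℝ (Fin n) → ℝ}
    (hf : ∀ j ∈ s, DifferentiableAt ℝ (f j) y) :
    partialDeriv i (fun y => ∑ j ∈ s, f j y) y = ∑ j ∈ s, partialDeriv i (f j) y := by
  simp only [partialDeriv]
  rw [fderiv_fun_sum hf]
  simp

theorem partialDeriv_coord (j : Fin n) :
    partialDeriv i (fun y : EuclideanSpace ℝ (Fin n) => y j) y = if i = j then 1 else 0 := by
  have : HasFDerivAt (fun y : EuclideanSpace ℝ (Fin n) => y j)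
      (EuclideanSpace.proj j : EuclideanSpace ℝ (Fin n) →L[ℝ] ℝ) y :=
    (EuclideanSpace.proj j : EuclideanSpace ℝ (Fin n) →L[ℝ] ℝ).hasFDerivAt
  rw [partialDeriv, this.fderiv]
  simp [eq_comm]

theorem partialDeriv_comm {v : EuclideanSpace ℝ (Fin n) → ℝ} (hv : ContDiff ℝ ∞ v) (i j : Fin n)
    (y : EuclideanSpace ℝ (Fin n)) :
    partialDeriv i (partialDeriv j v) y = partialDeriv j (partialDeriv i v) y := by
  have h : ∀ k l : Fin n, partialDeriv k (partialDeriv l v) y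
      = fderiv ℝ (fderiv ℝ v) y (EuclideanSpace.single k 1) (EuclideanSpace.single l 1) := by
    intro k l
    have hd : DifferentiableAt ℝ (fderiv ℝ v) y :=
      (hv.fderiv_right (m := ∞) (by simp)).differentiable (by simp) y
    change fderiv ℝ (fun y => fderiv ℝ v y (EuclideanSpace.single l 1)) y _ = _
    rw [fderiv_clm_apply hd (by fun_prop)]
    simp
  rw [h, h]
  exact (hv.contDiffAt.isSymmSndFDerivAt (by simp; exact ENat.LEInfty.out)).eq _ _

end Radial

theorem contDiff_of_contDiffAt_tsupport {E F : Type*} [NormedAddCommGroup E] [NormedSpace ℝ E]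
    [NormedAddCommGroup F] [NormedSpace ℝ F] {k : WithTop ℕ∞} {f : E → F}
    (h : ∀ x ∈ tsupport f, ContDiffAt ℝ k f x) : ContDiff ℝ k f := by
  refine contDiff_iff_contDiffAt.2 fun x => ?_
  by_cases hx : x ∈ tsupport f
  · exact h x hx
  · exact contDiffAt_const.congr_of_eventuallyEq (notMem_tsupport_iff_eventuallyEq.1 hx)

/-! ### Rellich-type divergence identities -/

section Divergence

variable {n : ℕ}

/-- The derivative `y · ∇v` along the dilation field. -/
noncomputable def eulerDeriv (v : EuclideanSpace ℝ (Fin n) → ℝ) (y : EuclideanSpace ℝ (Fin n)) :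
    ℝ :=
  ∑ j, y j * partialDeriv j v y

/-- The squared norm `|∇v|²` of the classical gradient. -/
noncomputable def gradNormSq (v : EuclideanSpace ℝ (Fin n) → ℝ) (y : EuclideanSpace ℝ (Fin n)) :
    ℝ :=
  ∑ j, partialDeriv j v y ^ 2

variable {v : EuclideanSpace ℝ (Fin n) → ℝ}

theorem contDiff_coord (j : Fin n) :
    ContDiff ℝ ∞ fun y : EuclideanSpace ℝ (Fin n) => y j :=
  (EuclideanSpace.proj j : EuclideanSpace ℝ (Fin n) →L[ℝ] ℝ).contDiff

theorem contDiff_eulerDeriv (hv : ContDiff ℝ ∞ v) : ContDiff ℝ ∞ (eulerDeriv v) :=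
  ContDiff.sum fun j _ => (contDiff_coord j).mul (hv.partialDeriv j)

theorem contDiff_gradNormSq (hv : ContDiff ℝ ∞ v) : ContDiff ℝ ∞ (gradNormSq v) :=
  ContDiff.sum fun j _ => (hv.partialDeriv j).pow 2

theorem partialDeriv_eulerDeriv (hv : ContDiff ℝ ∞ v) (i : Fin n)
    (y : EuclideanSpace ℝ (Fin n)) :
    partialDeriv i (eulerDeriv v) y
      = partialDeriv i v y + ∑ j, y j * partialDeriv i (partialDeriv j v) y := by
  have hc := fun j => (contDiff_coord (n := n) j).differentiable (by simp) y
  have hp := fun j => (hv.partialDeriv j).differentiable (by simp) y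
  have h : partialDeriv i (eulerDeriv v) y
      = ∑ j, partialDeriv i (fun y => y j * partialDeriv j v y) y :=
    partialDeriv_sum fun j _ => (hc j).mul (hp j)
  rw [h]
  simp_rw [fun j => partialDeriv_mul (i := i) (hc j) (hp j), partialDeriv_coord,
    Finset.sum_add_distrib]
  simp

theorem partialDeriv_gradNormSq (hv : ContDiff ℝ ∞ v) (i : Fin n)
    (y : EuclideanSpace ℝ (Fin n)) :
    partialDeriv i (gradNormSq v) y
      = 2 * ∑ j, partialDeriv j v y * partialDeriv i (partialDeriv j v) y := by
  have hp := fun j => (hv.partialDeriv j).differentiable (by simp) y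
  have h : partialDeriv i (gradNormSq v) y
      = ∑ j, partialDeriv i (fun y => partialDeriv j v y * partialDeriv j v y) y := by
    have : gradNormSq v = fun y => ∑ j, partialDeriv j v y * partialDeriv j v y := by
      funext y; simp only [gradNormSq, sq]
    rw [this]
    exact partialDeriv_sum fun j _ => (hp j).mul (hp j)
  rw [h]
  simp_rw [fun j => partialDeriv_mul (i := i) (hp j) (hp j), Finset.mul_sum]
  exact Finset.sum_congr rfl fun j _ => by ring

theorem sum_sq_coord (y : EuclideanSpace ℝ (Fin n)) : ∑ i, y i * y i = ‖y‖ ^ 2 := by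
  rw [EuclideanSpace.real_norm_sq_eq]
  exact Finset.sum_congr rfl fun i _ => (sq _).symm

/-- The Rellich identity. Differentiating `y·∇v` along `∇v` produces `|∇v|²` and the Hessian paired
with `y` and `∇v`; half the derivative of `|∇v|²` along `y` produces the same Hessian term, by
symmetry, and the two cancel. -/
theorem partialDeriv_sub_half_gradNormSq (hv : ContDiff ℝ ∞ v) (y : EuclideanSpace ℝ (Fin n)) :
    ∑ i, partialDeriv i (fun y => eulerDeriv v y * partialDeriv i v y
        + (-(1 / 2)) * (gradNormSq v y * y i)) y
      = eulerDeriv v y * coordLaplacian v y + (1 - (n : ℝ) / 2) * gradNormSq v y := by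
  have hc := fun j => (contDiff_coord (n := n) j).differentiable (by simp) y
  have hp := fun j => (hv.partialDeriv j).differentiable (by simp) y
  have he := (contDiff_eulerDeriv hv).differentiable (by simp) y
  have hN := (contDiff_gradNormSq hv).differentiable (by simp) y
  have h1 : ∀ i, partialDeriv i (fun y => eulerDeriv v y * partialDeriv i v y
        + (-(1 / 2)) * (gradNormSq v y * y i)) y
      = partialDeriv i v y ^ 2 + (∑ j, y j * partialDeriv i (partialDeriv j v) y
          * partialDeriv i v y) + eulerDeriv v y * partialDeriv i (partialDeriv i v) y
        - (∑ j, partialDeriv j v y * partialDeriv i (partialDeriv j v) y * y i)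
        - 1 / 2 * gradNormSq v y := fun i => by
    rw [partialDeriv_add (he.fun_mul (hp i)) ((hN.fun_mul (hc i)).const_mul _),
      partialDeriv_const_mul _ (hN.fun_mul (hc i)), partialDeriv_mul he (hp i),
      partialDeriv_mul hN (hc i), partialDeriv_eulerDeriv hv, partialDeriv_gradNormSq hv,
      partialDeriv_coord, ← Finset.sum_mul, ← Finset.sum_mul]
    simp
    ring
  have hswap : ∑ i, ∑ j, partialDeriv j v y * partialDeriv i (partialDeriv j v) y * y i
      = ∑ i, ∑ j, y j * partialDeriv i (partialDeriv j v) y * partialDeriv i v y := by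
    rw [Finset.sum_comm]
    refine Finset.sum_congr rfl fun i _ => Finset.sum_congr rfl fun j _ => ?_
    rw [partialDeriv_comm hv i j]
    ring
  simp_rw [h1, Finset.sum_sub_distrib, Finset.sum_add_distrib, hswap, ← Finset.mul_sum]
  simp [coordLaplacian]
  rw [← gradNormSq]
  ring

theorem sum_partialDeriv_radial_mul {γ : ℝ → ℝ} {γ' : ℝ} {y : EuclideanSpace ℝ (Fin n)}
    (hy : y ≠ 0) (hγ : HasDerivAt γ γ' ‖y‖) {A : Fin n → EuclideanSpace ℝ (Fin n) → ℝ}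
    (hA : ∀ i, DifferentiableAt ℝ (A i) y) :
    ∑ i, partialDeriv i (fun y => γ ‖y‖ * A i y) y
      = γ' / ‖y‖ * (∑ i, y i * A i y) + γ ‖y‖ * ∑ i, partialDeriv i (A i) y := by
  have h : ∀ i, partialDeriv i (fun y => γ ‖y‖ * A i y) y
      = γ' / ‖y‖ * (y i * A i y) + γ ‖y‖ * partialDeriv i (A i) y := fun i => by
    obtain ⟨hd, he⟩ := partialDeriv_radial hy hγ i
    rw [partialDeriv_mul hd (hA i), he]
    ring
  simp_rw [h, Finset.sum_add_distrib, ← Finset.mul_sum]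

/-- The divergence of `κ (y·∇v ∇v - |∇v|²/2 y) + g v ∇v + m v² y` with radial `κ`, `g`, `m`. -/
noncomputable def rellichDivergence (κ g m : ℝ → ℝ) (v : EuclideanSpace ℝ (Fin n) → ℝ)
    (y : EuclideanSpace ℝ (Fin n)) : ℝ :=
  κ ‖y‖ * (eulerDeriv v y * coordLaplacian v y + (1 - (n : ℝ) / 2) * gradNormSq v y)
    + deriv κ ‖y‖ / ‖y‖ * (eulerDeriv v y ^ 2 - 1 / 2 * ‖y‖ ^ 2 * gradNormSq v y)
    + g ‖y‖ * (gradNormSq v y + v y * coordLaplacian v y)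
    + deriv g ‖y‖ / ‖y‖ * (v y * eulerDeriv v y)
    + m ‖y‖ * (2 * v y * eulerDeriv v y + n * v y ^ 2) + deriv m ‖y‖ * ‖y‖ * v y ^ 2

/-- The radial factors may be singular at the origin, but `v` vanishes near it, so the field is `C¹`
with compact support and its divergence integrates to zero. -/
theorem integral_rellichDivergence {κ g m : ℝ → ℝ} (hκ : ContDiffOn ℝ 1 κ (Ioi 0))
    (hg : ContDiffOn ℝ 1 g (Ioi 0)) (hm : ContDiffOn ℝ 1 m (Ioi 0)) (hv : ContDiff ℝ ∞ v)
    (hvc : HasCompactSupport v) (hv0 : (0 : EuclideanSpace ℝ (Fin n)) ∉ tsupport v) :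
    Integrable (rellichDivergence κ g m v) ∧ ∫ y, rellichDivergence κ g m v y = 0 := by
  set A : Fin n → EuclideanSpace ℝ (Fin n) → ℝ := fun i y => eulerDeriv v y * partialDeriv i v y
        + (-(1 / 2)) * (gradNormSq v y * y i) with hA
  set B : Fin n → EuclideanSpace ℝ (Fin n) → ℝ := fun i y => v y * partialDeriv i v y with hB
  set C : Fin n → EuclideanSpace ℝ (Fin n) → ℝ := fun i y => v y * v y * y i with hC
  set F : Fin n → EuclideanSpace ℝ (Fin n) → ℝ := fun i y =>
    κ ‖y‖ * A i y + g ‖y‖ * B i y + m ‖y‖ * C i y with hF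
  have hAs : ∀ i, ContDiff ℝ ∞ (A i) := fun i =>
    ((contDiff_eulerDeriv hv).mul (hv.partialDeriv i)).add
      (contDiff_const.mul ((contDiff_gradNormSq hv).mul (contDiff_coord i)))
  have hBs : ∀ i, ContDiff ℝ ∞ (B i) := fun i => hv.mul (hv.partialDeriv i)
  have hCs : ∀ i, ContDiff ℝ ∞ (C i) := fun i => (hv.mul hv).mul (contDiff_coord i)
  have hnorm : ∀ y : EuclideanSpace ℝ (Fin n), y ≠ 0 → ∀ γ : ℝ → ℝ, ContDiffOn ℝ 1 γ (Ioi 0) →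
      ContDiffAt ℝ 1 (fun y : EuclideanSpace ℝ (Fin n) => γ ‖y‖) y := fun y hy γ hγ =>
    (hγ.contDiffAt (Ioi_mem_nhds (norm_pos_iff.2 hy))).comp y (contDiffAt_norm ℝ hy)
  have hdγ : ∀ y : EuclideanSpace ℝ (Fin n), y ≠ 0 → ∀ γ : ℝ → ℝ, ContDiffOn ℝ 1 γ (Ioi 0) →
      HasDerivAt γ (deriv γ ‖y‖) ‖y‖ := fun y hy γ hγ =>
    ((hγ.contDiffAt (Ioi_mem_nhds (norm_pos_iff.2 hy))).differentiableAt (by simp)).hasDerivAt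
  have hp0 : ∀ y, y ∉ tsupport v → ∀ i, partialDeriv i v y = 0 := fun y hy i =>
    image_eq_zero_of_notMem_tsupport fun h => hy (tsupport_partialDeriv_subset v i h)
  have hv0' : ∀ y, y ∉ tsupport v → v y = 0 := fun y hy => image_eq_zero_of_notMem_tsupport hy
  have hFs : ∀ i, tsupport (F i) ⊆ tsupport v := fun i => by
    refine closure_minimal (fun y hy => ?_) (isClosed_tsupport v)
    by_contra h
    exact hy (by simp [F, A, B, C, hp0 y h, hv0' y h, gradNormSq])
  have hF1 : ∀ i, ContDiff ℝ 1 (F i) := fun i => by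
    refine contDiff_of_contDiffAt_tsupport fun y hy => ?_
    have hy0 : y ≠ 0 := fun h => hv0 (h ▸ hFs i hy)
    have h1 : ∀ {f : EuclideanSpace ℝ (Fin n) → ℝ}, ContDiff ℝ ∞ f → ContDiffAt ℝ 1 f y :=
      fun hf => hf.contDiffAt.of_le (by exact_mod_cast le_top)
    exact (((hnorm y hy0 κ hκ).mul (h1 (hAs i))).add ((hnorm y hy0 g hg).mul (h1 (hBs i)))).add
      ((hnorm y hy0 m hm).mul (h1 (hCs i)))
  have hint := fun i => integral_partialDeriv_eq_zero (hF1 i)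
    (hvc.of_isClosed_subset (isClosed_tsupport _) (hFs i)) i
  have hdiv : ∀ y, rellichDivergence κ g m v y = ∑ i, partialDeriv i (F i) y := by
    intro y
    by_cases hy : y ∈ tsupport v
    · have hy0 : y ≠ 0 := fun h => hv0 (h ▸ hy)
      have hr : ‖y‖ ≠ 0 := norm_ne_zero_iff.2 hy0
      have hdA := fun i => (hAs i).differentiable (by simp) y
      have hdB := fun i => (hBs i).differentiable (by simp) y
      have hdC := fun i => (hCs i).differentiable (by simp) y
      have hdv := hv.differentiable (by simp) y
      have hd1 : ∀ i, partialDeriv i (F i) y = partialDeriv i (fun y => κ ‖y‖ * A i y) y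
          + partialDeriv i (fun y => g ‖y‖ * B i y) y
          + partialDeriv i (fun y => m ‖y‖ * C i y) y := fun i => by
        have a := (partialDeriv_radial hy0 (hdγ y hy0 κ hκ) i).1.fun_mul (hdA i)
        have b := (partialDeriv_radial hy0 (hdγ y hy0 g hg) i).1.fun_mul (hdB i)
        have c := (partialDeriv_radial hy0 (hdγ y hy0 m hm) i).1.fun_mul (hdC i)
        rw [← partialDeriv_add a b, ← partialDeriv_add (a.fun_add b) c]
      simp_rw [hd1, Finset.sum_add_distrib]
      rw [sum_partialDeriv_radial_mul hy0 (hdγ y hy0 κ hκ) hdA,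
        sum_partialDeriv_radial_mul hy0 (hdγ y hy0 g hg) hdB,
        sum_partialDeriv_radial_mul hy0 (hdγ y hy0 m hm) hdC]
      have eA : ∑ i, y i * A i y = eulerDeriv v y ^ 2 - 1 / 2 * ‖y‖ ^ 2 * gradNormSq v y := by
        have : ∀ i, y i * A i y = eulerDeriv v y * (y i * partialDeriv i v y)
            - 1 / 2 * gradNormSq v y * (y i * y i) := fun i => by simp only [A]; ring
        simp_rw [this, Finset.sum_sub_distrib, ← Finset.mul_sum, sum_sq_coord]
        rw [← eulerDeriv]; ring
      have eA' : ∑ i, partialDeriv i (A i) y = eulerDeriv v y * coordLaplacian v y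
          + (1 - (n : ℝ) / 2) * gradNormSq v y := partialDeriv_sub_half_gradNormSq hv y
      have eB : ∑ i, y i * B i y = v y * eulerDeriv v y := by
        rw [eulerDeriv, Finset.mul_sum]
        exact Finset.sum_congr rfl fun i _ => by simp only [B]; ring
      have eB' : ∑ i, partialDeriv i (B i) y = gradNormSq v y + v y * coordLaplacian v y := by
        have : ∀ i, partialDeriv i (B i) y = partialDeriv i v y ^ 2
            + v y * partialDeriv i (partialDeriv i v) y := fun i => by
          rw [partialDeriv_mul hdv ((hv.partialDeriv i).differentiable (by simp) y)]; ring
        simp_rw [this, Finset.sum_add_distrib, ← Finset.mul_sum]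
        rfl
      have eC : ∑ i, y i * C i y = ‖y‖ ^ 2 * v y ^ 2 := by
        rw [← sum_sq_coord, Finset.sum_mul]
        exact Finset.sum_congr rfl fun i _ => by simp only [C]; ring
      have eC' : ∑ i, partialDeriv i (C i) y = 2 * v y * eulerDeriv v y + n * v y ^ 2 := by
        have : ∀ i, partialDeriv i (C i) y = 2 * v y * (y i * partialDeriv i v y)
            + v y ^ 2 := fun i => by
          rw [partialDeriv_mul (hdv.fun_mul hdv) ((contDiff_coord i).differentiable (by simp) y),
            partialDeriv_mul hdv hdv, partialDeriv_coord]
          simp; ring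
        simp_rw [this, Finset.sum_add_distrib, ← Finset.mul_sum]
        simp [eulerDeriv]
      rw [eA, eA', eB, eB', eC, eC', rellichDivergence]
      field_simp
      ring
    · have h1 : coordLaplacian v y = 0 := image_eq_zero_of_notMem_tsupport fun h =>
        hy (tsupport_coordLaplacian_subset v h)
      have h2 : ∀ i, partialDeriv i (F i) y = 0 := fun i =>
        image_eq_zero_of_notMem_tsupport fun h =>
          hy (hFs i (tsupport_partialDeriv_subset (F i) i h))
      simp [rellichDivergence, h1, h2, hp0 y hy, hv0' y hy, gradNormSq, eulerDeriv]
  have hfun : rellichDivergence κ g m v = fun y => ∑ i, partialDeriv i (F i) y := funext hdiv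
  rw [hfun]
  refine ⟨integrable_finsetSum _ fun i _ => (hint i).1, ?_⟩
  rw [integral_finsetSum _ fun i _ => (hint i).1]
  exact Finset.sum_eq_zero fun i _ => (hint i).2

end Divergence

/-! ### The Carleman estimate for real smooth functions -/

section SmoothCarleman

variable {n : ℕ}

/-- The hypothesis on `θ` is normalised so that `∇(θ(|y|)) = a θ y`, which keeps the conjugated
operators free of quotients by `|y|`. -/
theorem partialDeriv_radial_gauge {θ a : ℝ → ℝ}
    (hθ : ∀ r, 0 < r → HasDerivAt θ (a r * r * θ r) r) {u v : EuclideanSpace ℝ (Fin n) → ℝ}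
    (hv : ContDiff ℝ ∞ v) (huv : ∀ z, z ≠ 0 → u z = θ ‖z‖ * v z) {y : EuclideanSpace ℝ (Fin n)}
    (hy : y ≠ 0) (i : Fin n) :
    partialDeriv i u y = θ ‖y‖ * (partialDeriv i v y + a ‖y‖ * (y i * v y)) := by
  have hr := norm_pos_iff.2 hy
  have h1 : partialDeriv i u y = partialDeriv i (fun z => θ ‖z‖ * v z) y := by
    have : u =ᶠ[𝓝 y] fun z => θ ‖z‖ * v z :=
      (isOpen_ne.eventually_mem hy).mono huv
    rw [partialDeriv, this.fderiv_eq]; rfl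
  obtain ⟨hd, he⟩ := partialDeriv_radial hy (hθ _ hr) i
  rw [h1, partialDeriv_mul hd (hv.differentiable (by simp) y), he]
  field_simp
  ring

theorem coordLaplacian_radial_gauge {θ a : ℝ → ℝ}
    (hθ : ∀ r, 0 < r → HasDerivAt θ (a r * r * θ r) r) {u v : EuclideanSpace ℝ (Fin n) → ℝ}
    (hv : ContDiff ℝ ∞ v) (huv : ∀ z, z ≠ 0 → u z = θ ‖z‖ * v z) {y : EuclideanSpace ℝ (Fin n)}
    (hy : y ≠ 0) {a' : ℝ} (ha : HasDerivAt a a' ‖y‖) :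
    coordLaplacian u y = θ ‖y‖ * (coordLaplacian v y + 2 * a ‖y‖ * eulerDeriv v y
      + (a ‖y‖ ^ 2 * ‖y‖ ^ 2 + a' * ‖y‖ + n * a ‖y‖) * v y) := by
  have hr := norm_pos_iff.2 hy
  have hdv := hv.differentiable (by simp) y
  have h1 : ∀ i, partialDeriv i (partialDeriv i u) y
      = θ ‖y‖ * (partialDeriv i (partialDeriv i v) y + 2 * a ‖y‖ * (y i * partialDeriv i v y)
        + (a ‖y‖ ^ 2 + a' / ‖y‖) * v y * (y i * y i) + a ‖y‖ * v y) := fun i => by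
    have he : partialDeriv i u
        =ᶠ[𝓝 y] fun z => θ ‖z‖ * (partialDeriv i v z + a ‖z‖ * (z i * v z)) :=
      (isOpen_ne.eventually_mem hy).mono fun z hz =>
        partialDeriv_radial_gauge hθ hv huv hz i
    have hpe : partialDeriv i (partialDeriv i u) y = partialDeriv i
        (fun z => θ ‖z‖ * (partialDeriv i v z + a ‖z‖ * (z i * v z))) y := by
      rw [partialDeriv, he.fderiv_eq]; rfl
    obtain ⟨hdθ, heθ⟩ := partialDeriv_radial hy (hθ _ hr) i
    obtain ⟨hda, hea⟩ := partialDeriv_radial hy ha i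
    have hdc := (contDiff_coord (n := n) i).differentiable (by simp) y
    have hdp := (hv.partialDeriv i).differentiable (by simp) y
    rw [hpe, partialDeriv_mul hdθ (hdp.fun_add (hda.fun_mul (hdc.fun_mul hdv))),
      partialDeriv_add hdp (hda.fun_mul (hdc.fun_mul hdv)), partialDeriv_mul hda (hdc.fun_mul hdv),
      partialDeriv_mul hdc hdv, heθ, hea, partialDeriv_coord]
    simp only [if_true]
    field_simp
    ring
  simp only [coordLaplacian, h1]
  rw [← Finset.mul_sum]
  simp_rw [Finset.sum_add_distrib, ← Finset.mul_sum, sum_sq_coord]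
  simp [eulerDeriv]
  left
  field_simp
  ring

/-- The coefficient of `σα v²/r` left over in `carleman_pointwise_algebra`, with `τ = σr`. The gain
`4α²q³` dominates: `q ≥ 1/3` gives `4q³ - q²/3 ≥ 1/9`, which pays for the reserved `1/20`, while `α
≥ 10n` makes all other terms small multiples of `α²`. -/
theorem carleman_coefficient_nonneg {n τ q α : ℝ} (hn : 1 ≤ n) (hτ0 : 0 < τ) (hτ : τ ≤ 1)
    (hq : 1 / 3 ≤ q) (hq1 : q ≤ 1) (hα : 10 * n ≤ α) :
    0 ≤ 4 * α ^ 2 * q ^ 3 - q * ((n - 1) ^ 2 - (2 * n - 1) * τ + τ ^ 2) - (n - 1) / 6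
      - α ^ 2 * q ^ 2 / 3 - τ * α / 36 - α ^ 2 / 20 := by
  have hα2 : 100 * n ^ 2 ≤ α ^ 2 := by nlinarith
  have h1 : 1 / 9 * α ^ 2 ≤ 4 * α ^ 2 * q ^ 3 - α ^ 2 * q ^ 2 / 3 := by
    have : 1 / 9 ≤ q ^ 2 * (4 * q - 1 / 3) := by nlinarith
    nlinarith [sq_nonneg α]
  have h2 : q * ((n - 1) ^ 2 - (2 * n - 1) * τ + τ ^ 2) ≤ n ^ 2 := by
    have : (n - 1) ^ 2 - (2 * n - 1) * τ + τ ^ 2 ≤ n ^ 2 := by nlinarith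
    by_cases h0 : 0 ≤ (n - 1) ^ 2 - (2 * n - 1) * τ + τ ^ 2
    · nlinarith
    · nlinarith [sq_nonneg n]
  have h3 : τ * α ≤ α ^ 2 / 10 := by nlinarith
  nlinarith

/-- Here `X`, `e`, `N` stand for `Δv`, `y·∇v`, `|∇v|²`, and the bracket subtracted is
`carlemanDivergence`. Its factors are forced. `κ = 4αq` matches the product of `Δv` and `y·∇v` in
`2SA/r²`. The main part of `g` matches `vΔv`, and its gradient contribution cancels those of `κ` and
`κ'`. The three terms of `m` remove `v y·∇v` from `2SA/r²` and from the two parts of `g'`. The extra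
`-σαr/3` in `g` creates the gradient term on the left; the accompanying `vΔv` is absorbed by
shifting the first square by `σαv/6`. What remains is the sum of nonnegative terms displayed in the
proof. -/
theorem carleman_pointwise_algebra {n σ r q α X e N v : ℝ} (hn : 1 ≤ n) (hσ : 0 < σ) (hr : 0 < r)
    (hσr : σ * r ≤ 1) (hq : 1 / 3 ≤ q) (hq1 : q ≤ 1) (hα : 10 * n ≤ α) :
    1 / 3 * σ * α * r * N + 1 / 20 * σ * α ^ 3 * v ^ 2 / r ≤
      r ^ 2 * (X + 2 * (α * q / r ^ 2) * e
        + (α ^ 2 * q ^ 2 / r ^ 2 + α * q * (n - 2 - σ * r) / r ^ 2) * v) ^ 2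
      - (4 * α * q * (e * X + (1 - n / 2) * N)
        + (-4 * α * σ * q) / r * (e ^ 2 - 1 / 2 * r ^ 2 * N)
        + (2 * α * q * (n - 2 - σ * r) - 1 / 3 * σ * α * r) * (N + v * X)
        + (-2 * α * σ * q * (n - 1 - σ * r) - 1 / 3 * σ * α) / r * (v * e)
        + (2 * α ^ 3 * q ^ 3 / r ^ 2 + α * σ * q * (n - 1 - σ * r) / r + σ * α / (6 * r))
          * (2 * v * e + n * v ^ 2)
        + (-6 * α ^ 3 * σ * q ^ 3 / r ^ 2 - 4 * α ^ 3 * q ^ 3 / r ^ 3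
          - α * σ * q * (σ * (n - 1 - σ * r) / r + σ / r + (n - 1 - σ * r) / r ^ 2)
          - σ * α / (6 * r ^ 2)) * r * v ^ 2) := by
  have hα0 : 0 < α := by linarith
  have hq0 : 0 < q := by linarith
  have hZ := carleman_coefficient_nonneg hn (mul_pos hσ hr) hσr hq hq1 hα
  rw [← sub_nonneg]
  have key : ∀ Z, Z = 4 * α ^ 2 * q ^ 3
      - q * ((n - 1) ^ 2 - (2 * n - 1) * (σ * r) + (σ * r) ^ 2) - (n - 1) / 6
      - α ^ 2 * q ^ 2 / 3 - (σ * r) * α / 36 - α ^ 2 / 20 →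
      0 ≤ ((r ^ 2 * X + α ^ 2 * q ^ 2 * v) / r + σ * α / 6 * v) ^ 2
      + ((2 * α * q * e + α * q * (n - 2 - σ * r) * v) / r) ^ 2 + 4 * α * σ * q * e ^ 2 / r
      + σ * α / r * Z * v ^ 2 := fun Z hZ' => by
    have : 0 ≤ Z := hZ' ▸ hZ
    positivity
  refine (key _ rfl).trans_eq ?_
  field_simp
  ring

theorem contDiff_carlemanWeight_rpow_mul {ρ : ℝ} (hρ : 0 < ρ) (p : ℝ) {F : Type*}
    [NormedAddCommGroup F] [NormedSpace ℝ F] {f : EuclideanSpace ℝ (Fin n) → F}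
    (hf : ContDiff ℝ ∞ f) (hf0 : (0 : EuclideanSpace ℝ (Fin n)) ∉ tsupport f) :
    ContDiff ℝ ∞ fun y => carlemanWeight ρ y ^ p • f y :=
  contDiff_of_contDiffAt_tsupport fun _ hy => (contDiffAt_carlemanWeight_rpow hρ p fun h =>
    hf0 (h ▸ tsupport_smul_subset_right _ f hy)).smul hf.contDiffAt

theorem integrable_carlemanWeight_rpow_mul {ρ : ℝ} (hρ : 0 < ρ) (p : ℝ)
    {f : EuclideanSpace ℝ (Fin n) → ℝ} (hf : ContDiff ℝ ∞ f) (hc : HasCompactSupport f)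
    (hf0 : (0 : EuclideanSpace ℝ (Fin n)) ∉ tsupport f) :
    Integrable fun y => carlemanWeight ρ y ^ p * f y := by
  have h := (contDiff_carlemanWeight_rpow_mul hρ p hf hf0).continuous
  simp only [smul_eq_mul] at h
  exact h.integrable_of_hasCompactSupport hc.mul_left

theorem hasCompactSupport_of_tsupport_subset_ball {F : Type*} [Zero F]
    {f : EuclideanSpace ℝ (Fin n) → F} {ρ : ℝ} {S : Set (EuclideanSpace ℝ (Fin n))}
    (h : tsupport f ⊆ Metric.ball 0 ρ \ S) : HasCompactSupport f :=
  Metric.isCompact_of_isClosed_isBounded (isClosed_tsupport f)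
    (Metric.isBounded_ball.subset (h.trans sdiff_subset))

/-- The divergence of the vector field in the proof of the Carleman estimate. -/
noncomputable def carlemanDivergence (ρ α : ℝ) (v : EuclideanSpace ℝ (Fin n) → ℝ) :
    EuclideanSpace ℝ (Fin n) → ℝ :=
  rellichDivergence (fun r => 4 * α * Real.exp (-(ρ⁻¹ * r)))
    (fun r => 2 * α * Real.exp (-(ρ⁻¹ * r)) * (n - 2 - ρ⁻¹ * r) - 1 / 3 * ρ⁻¹ * α * r)
    (fun r => 2 * α ^ 3 * Real.exp (-(ρ⁻¹ * r)) ^ 3 / r ^ 2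
      + α * ρ⁻¹ * Real.exp (-(ρ⁻¹ * r)) * (n - 1 - ρ⁻¹ * r) / r + ρ⁻¹ * α / (6 * r)) v

theorem integral_carlemanDivergence (ρ α : ℝ) {v : EuclideanSpace ℝ (Fin n) → ℝ}
    (hv : ContDiff ℝ ∞ v) (hvc : HasCompactSupport v)
    (hv0 : (0 : EuclideanSpace ℝ (Fin n)) ∉ tsupport v) :
    Integrable (carlemanDivergence ρ α v) ∧ ∫ y, carlemanDivergence ρ α v y = 0 := by
  refine integral_rellichDivergence (by fun_prop) (by fun_prop) ?_ hv hvc hv0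
  refine ((ContDiffOn.div (by fun_prop) (by fun_prop) fun r hr => ?_).add
    (ContDiffOn.div (by fun_prop) (by fun_prop) fun r hr => ?_)).add
    (ContDiffOn.div (by fun_prop) (by fun_prop) fun r hr => ?_)
  all_goals simp only [mem_Ioi] at hr; positivity

theorem hasDerivAt_exp_neg_mul (c r : ℝ) :
    HasDerivAt (fun r => Real.exp (-(c * r))) (-c * Real.exp (-(c * r))) r :=
  (((hasDerivAt_id r).const_mul c).neg.exp).congr_deriv (by simp; ring)

theorem carlemanDivergence_eq (ρ α : ℝ) (v : EuclideanSpace ℝ (Fin n) → ℝ)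
    {y : EuclideanSpace ℝ (Fin n)} (hy : y ≠ 0) {σ r q : ℝ} (hσ : σ = ρ⁻¹) (hr : r = ‖y‖)
    (hq : q = Real.exp (-(ρ⁻¹ * ‖y‖))) : carlemanDivergence ρ α v y =
      4 * α * q * (eulerDeriv v y * coordLaplacian v y + (1 - n / 2) * gradNormSq v y)
        + (-4 * α * σ * q) / r * (eulerDeriv v y ^ 2 - 1 / 2 * r ^ 2 * gradNormSq v y)
        + (2 * α * q * (n - 2 - σ * r) - 1 / 3 * σ * α * r)
          * (gradNormSq v y + v y * coordLaplacian v y)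
        + (-2 * α * σ * q * (n - 1 - σ * r) - 1 / 3 * σ * α) / r * (v y * eulerDeriv v y)
        + (2 * α ^ 3 * q ^ 3 / r ^ 2 + α * σ * q * (n - 1 - σ * r) / r + σ * α / (6 * r))
          * (2 * v y * eulerDeriv v y + n * v y ^ 2)
        + (-6 * α ^ 3 * σ * q ^ 3 / r ^ 2 - 4 * α ^ 3 * q ^ 3 / r ^ 3
          - α * σ * q * (σ * (n - 1 - σ * r) / r + σ / r + (n - 1 - σ * r) / r ^ 2)
          - σ * α / (6 * r ^ 2)) * r * v y ^ 2 := by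
  have hr0 : 0 < ‖y‖ := norm_pos_iff.2 hy
  have hlin : ∀ c r, HasDerivAt (fun r => c - ρ⁻¹ * r) (-ρ⁻¹) r := fun c r =>
    (((hasDerivAt_id r).const_mul ρ⁻¹).const_sub c).congr_deriv (by simp)
  have hqd := hasDerivAt_exp_neg_mul ρ⁻¹ ‖y‖
  have hr6 : (6 : ℝ) * ‖y‖ ≠ 0 := by positivity
  have h1 := (hqd.const_mul (4 * α)).deriv
  have h2 := (((hqd.const_mul (2 * α)).fun_mul (hlin (n - 2) ‖y‖)).fun_sub
      ((hasDerivAt_id' ‖y‖).const_mul (1 / 3 * ρ⁻¹ * α))).deriv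
  have h3 := (((((hqd.fun_pow 3).const_mul (2 * α ^ 3)).fun_div (hasDerivAt_pow 2 ‖y‖)
      (by positivity)).fun_add (((hqd.const_mul (α * ρ⁻¹)).fun_mul
      (hlin (n - 1) ‖y‖)).fun_div (hasDerivAt_id' ‖y‖) hr0.ne')).fun_add
      ((hasDerivAt_const ‖y‖ (ρ⁻¹ * α)).fun_div ((hasDerivAt_id' ‖y‖).const_mul 6) hr6)).deriv
  rw [carlemanDivergence, rellichDivergence, h1, h2, h3, ← hq, ← hσ, ← hr]
  rw [← hr] at hr0
  generalize eulerDeriv v y = e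
  generalize coordLaplacian v y = X
  generalize gradNormSq v y = N
  generalize v y = v
  congr 1
  · congr 1
    congr 1
    · congr 2
      ring
    · congr 2
      ring
  · congr 2
    field_simp
    ring

/-- The inequality `(a + b)² ≤ 2a² + 2b²` for the two terms of the conjugated gradient, summed with
`∑ yᵢ² = |y|²`. -/
theorem gradNormSq_gauge_le {f v : EuclideanSpace ℝ (Fin n) → ℝ} {y : EuclideanSpace ℝ (Fin n)}
    (hy : y ≠ 0) {z c α : ℝ} (hc0 : 0 ≤ c) (hcα : c ≤ α)
    (h : ∀ i, partialDeriv i f y = z * (partialDeriv i v y + c / ‖y‖ ^ 2 * (y i * v y))) :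
    gradNormSq f y ≤ z ^ 2 * (2 * gradNormSq v y + 2 * α ^ 2 * v y ^ 2 / ‖y‖ ^ 2) := by
  have hr : 0 < ‖y‖ := norm_pos_iff.2 hy
  have h1 : ∀ i, partialDeriv i f y ^ 2 ≤ z ^ 2 * (2 * partialDeriv i v y ^ 2
      + 2 * (c / ‖y‖ ^ 2 * v y) ^ 2 * (y i * y i)) := fun i => by
    rw [h i, mul_pow]
    refine mul_le_mul_of_nonneg_left ?_ (sq_nonneg _)
    nlinarith [sq_nonneg (partialDeriv i v y - c / ‖y‖ ^ 2 * (y i * v y))]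
  refine (Finset.sum_le_sum fun i _ => h1 i).trans ?_
  rw [← Finset.mul_sum, Finset.sum_add_distrib, ← Finset.mul_sum, ← Finset.mul_sum,
    sum_sq_coord, ← gradNormSq]
  have h2 : 2 * (c / ‖y‖ ^ 2 * v y) ^ 2 * ‖y‖ ^ 2 = 2 * c ^ 2 * v y ^ 2 / ‖y‖ ^ 2 := by
    field_simp
  rw [h2]
  gcongr

/-- Returns from `v` to `f`: the conjugation factor satisfies `(w^α)² w^{-2α} = 1`, and the leftover
powers of `w` are traded for powers of `r/ρ`. The factor 100 is fixed by the `v²` terms, `2 + 3 =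
100/20`: 2 from the gradient of `w^α` and 3 from `1/w ≤ 3ρ/r`. Then `900 = 100·9`, since `r² ≤
9ρ²w²`. -/
theorem carleman_weight_algebra {ρ r w α P N v G L f D : ℝ} (hρ : 0 < ρ) (hr : 0 < r) (hw : 0 < w)
    (hw1 : w ≤ r / ρ) (hw3 : r / ρ ≤ 3 * w) (hα : 1 ≤ α) (hN : 0 ≤ N)
    (hG : G ≤ (w ^ α) ^ 2 * (2 * N + 2 * α ^ 2 * v ^ 2 / r ^ 2)) (hf : f = w ^ α * v)
    (hL : L = w ^ α * P)
    (h : 1 / 3 * ρ⁻¹ * α * r * N + 1 / 20 * ρ⁻¹ * α ^ 3 * v ^ 2 / r ≤ r ^ 2 * P ^ 2 - D) :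
    α * ρ ^ 2 * w ^ (1 - 2 * α) * G + α ^ 3 * w ^ (-1 - 2 * α) * f ^ 2
    ≤ 900 * ρ ^ 4 * (w ^ (2 - 2 * α) * L ^ 2) - 100 * ρ ^ 2 * D := by
  have hz : (w ^ α) ^ 2 * w ^ (-2 * α) = 1 := by
    rw [← Real.rpow_natCast, ← Real.rpow_mul hw.le, ← Real.rpow_add hw]
    norm_num
    ring_nf
    simp
  have e1 : w ^ (1 - 2 * α) = w * w ^ (-2 * α) := by
    rw [← Real.rpow_one_add' hw.le (by linarith)]; ring_nf
  have e2 : w ^ (-1 - 2 * α) = w⁻¹ * w ^ (-2 * α) := by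
    rw [← Real.rpow_neg_one, ← Real.rpow_add hw]; ring_nf
  have e3 : w ^ (2 - 2 * α) = w ^ 2 * w ^ (-2 * α) := by
    rw [← Real.rpow_two, ← Real.rpow_add hw]; ring_nf
  have hz0 : 0 < w ^ (-2 * α) := Real.rpow_pos_of_pos hw _
  rw [e1, e2, e3, hf, hL]
  generalize w ^ (-2 * α) = x at *
  generalize w ^ α = z at *
  have hα0 : 0 < α := by linarith
  have t1 : α * ρ ^ 2 * (w * x) * G
      ≤ α * ρ ^ 2 * (r / ρ) * (2 * N + 2 * α ^ 2 * v ^ 2 / r ^ 2) := by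
    calc _ ≤ α * ρ ^ 2 * (w * x) * (z ^ 2 * (2 * N + 2 * α ^ 2 * v ^ 2 / r ^ 2)) := by gcongr
      _ = α * ρ ^ 2 * w * (z ^ 2 * x) * (2 * N + 2 * α ^ 2 * v ^ 2 / r ^ 2) := by ring
      _ ≤ _ := by rw [hz, mul_one]; gcongr
  have hwinv : w⁻¹ ≤ 3 * ρ / r := by
    rw [inv_le_iff_one_le_mul₀ hw]
    have : 3 * ρ / r * (r / ρ) = 3 := by field_simp
    have h0 : 0 < 3 * ρ / r := by positivity
    nlinarith
  have t2 : α ^ 3 * (w⁻¹ * x) * (z * v) ^ 2 ≤ α ^ 3 * (3 * ρ / r) * v ^ 2 := by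
    calc _ = α ^ 3 * w⁻¹ * (z ^ 2 * x) * v ^ 2 := by ring
      _ ≤ _ := by rw [hz, mul_one]; gcongr
  have t3 : r ^ 2 * P ^ 2 ≤ 9 * ρ ^ 2 * (w ^ 2 * x * (z * P) ^ 2) := by
    have : w ^ 2 * x * (z * P) ^ 2 = w ^ 2 * P ^ 2 := by
      calc _ = w ^ 2 * (z ^ 2 * x) * P ^ 2 := by ring
        _ = _ := by rw [hz, mul_one]
    rw [this]
    have h3 : r ≤ 3 * ρ * w := by
      rw [div_le_iff₀ hρ] at hw3; linarith
    have h4 : r ^ 2 ≤ (3 * ρ * w) ^ 2 := pow_le_pow_left₀ hr.le h3 2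
    calc _ ≤ (3 * ρ * w) ^ 2 * P ^ 2 := by gcongr
      _ = _ := by ring
  have t4 : α * ρ ^ 2 * (r / ρ) * (2 * N + 2 * α ^ 2 * v ^ 2 / r ^ 2)
      + α ^ 3 * (3 * ρ / r) * v ^ 2
      ≤ 100 * ρ ^ 2 * (1 / 3 * ρ⁻¹ * α * r * N + 1 / 20 * ρ⁻¹ * α ^ 3 * v ^ 2 / r) := by
    have h5 : 100 * ρ ^ 2 * (1 / 3 * ρ⁻¹ * α * r * N + 1 / 20 * ρ⁻¹ * α ^ 3 * v ^ 2 / r)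
        - (α * ρ ^ 2 * (r / ρ) * (2 * N + 2 * α ^ 2 * v ^ 2 / r ^ 2)
      + α ^ 3 * (3 * ρ / r) * v ^ 2) = 94 / 3 * ρ * α * r * N := by
      field_simp
      ring
    have : 0 ≤ 94 / 3 * ρ * α * r * N := by positivity
    linarith
  have t5 := mul_le_mul_of_nonneg_left h (by positivity : (0 : ℝ) ≤ 100 * ρ ^ 2)
  have t6 := mul_le_mul_of_nonneg_left t3 (by positivity : (0 : ℝ) ≤ 100 * ρ ^ 2)
  linarith

theorem carleman_pointwise {ρ : ℝ} (hρ : 0 < ρ) (hn : 1 ≤ n) {α : ℝ} (hα : 10 * n ≤ α)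
    {f v : EuclideanSpace ℝ (Fin n) → ℝ} (hv : ContDiff ℝ ∞ v)
    (hfv : ∀ z, z ≠ 0 → f z = carlemanPhi (‖z‖ / ρ) ^ α * v z)
    {y : EuclideanSpace ℝ (Fin n)} (hy : y ≠ 0) (hyρ : ‖y‖ ≤ ρ) :
    α * ρ ^ 2 * carlemanWeight ρ y ^ (1 - 2 * α) * gradNormSq f y
      + α ^ 3 * carlemanWeight ρ y ^ (-1 - 2 * α) * f y ^ 2
    ≤ 900 * ρ ^ 4 * (carlemanWeight ρ y ^ (2 - 2 * α) * coordLaplacian f y ^ 2)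
      - 100 * ρ ^ 2 * carlemanDivergence ρ α v y := by
  have hr : 0 < ‖y‖ := norm_pos_iff.2 hy
  have hσ : 0 < ρ⁻¹ := inv_pos.2 hρ
  have hσr : ρ⁻¹ * ‖y‖ ≤ 1 := by
    rw [inv_mul_le_iff₀ hρ]; simpa using hyρ
  have hn' : (1 : ℝ) ≤ n := by exact_mod_cast hn
  have hα1 : 1 ≤ α := by linarith
  have hθ : ∀ r, 0 < r → HasDerivAt (fun r => carlemanPhi (r / ρ) ^ α)
      ((fun r => α * Real.exp (-(ρ⁻¹ * r)) / r ^ 2) r * r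
        * (fun r => carlemanPhi (r / ρ) ^ α) r) r := fun r hr' => by
    refine (hasDerivAt_carlemanPhi_div_rpow hρ α hr').congr_deriv ?_
    rw [div_eq_inv_mul r ρ]
    field_simp
  have hq3 : 1 / 3 ≤ Real.exp (-(ρ⁻¹ * ‖y‖)) := one_third_le_exp_neg hσr
  have hq1 : Real.exp (-(ρ⁻¹ * ‖y‖)) ≤ 1 := Real.exp_le_one_iff.2 (by
    have := mul_pos hσ hr; linarith)
  have hgrad := fun i => partialDeriv_radial_gauge hθ hv hfv hy i
  have had : HasDerivAt (fun r => α * Real.exp (-(ρ⁻¹ * r)) / r ^ 2)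
      (-ρ⁻¹ * α * Real.exp (-(ρ⁻¹ * ‖y‖)) / ‖y‖ ^ 2
        - 2 * α * Real.exp (-(ρ⁻¹ * ‖y‖)) / ‖y‖ ^ 3) ‖y‖ := by
    refine (((hasDerivAt_exp_neg_mul ρ⁻¹ ‖y‖).const_mul α).fun_div (hasDerivAt_pow 2 ‖y‖)
      (by positivity)).congr_deriv ?_
    field_simp
    ring
  have hlap := coordLaplacian_radial_gauge hθ hv hfv hy had
  have hD := carlemanDivergence_eq ρ α v hy rfl rfl rfl
  have halg := carleman_pointwise_algebra (X := coordLaplacian v y) (e := eulerDeriv v y)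
    (N := gradNormSq v y) (v := v y) hn' hσ hr hσr hq3 hq1 hα
  rw [← hD] at halg
  refine carleman_weight_algebra hρ hr (carlemanWeight_pos hρ hy) (carlemanWeight_le hρ y)
    (norm_div_le_carlemanWeight hρ hyρ) hα1 (Finset.sum_nonneg fun i _ => sq_nonneg _)
    (gradNormSq_gauge_le hy (c := α * Real.exp (-(ρ⁻¹ * ‖y‖))) (by positivity)
      (mul_le_of_le_one_right (by linarith) hq1) hgrad) (hfv y hy) ?_ halg
  rw [hlap]
  refine congrArg (carlemanPhi (‖y‖ / ρ) ^ α * ·) ?_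
  refine congrArg₂ (· + ·) rfl (congrArg (· * v y) ?_)
  generalize Real.exp (-(ρ⁻¹ * ‖y‖)) = q
  field_simp
  ring

theorem carleman_of_real_contDiff {ρ : ℝ} (hρ : 0 < ρ) (hn : 1 ≤ n) {α : ℝ} (hα : 10 * n ≤ α)
    {f : EuclideanSpace ℝ (Fin n) → ℝ} (hf : ContDiff ℝ ∞ f)
    (hs : tsupport f ⊆ Metric.ball 0 ρ \ {0}) :
    Integrable (fun y => α * ρ ^ 2 * carlemanWeight ρ y ^ (1 - 2 * α) * gradNormSq f y
      + α ^ 3 * carlemanWeight ρ y ^ (-1 - 2 * α) * f y ^ 2) ∧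
    Integrable (fun y => carlemanWeight ρ y ^ (2 - 2 * α) * coordLaplacian f y ^ 2) ∧
    ∫ y, (α * ρ ^ 2 * carlemanWeight ρ y ^ (1 - 2 * α) * gradNormSq f y
      + α ^ 3 * carlemanWeight ρ y ^ (-1 - 2 * α) * f y ^ 2)
    ≤ 900 * ρ ^ 4 * ∫ y, carlemanWeight ρ y ^ (2 - 2 * α) * coordLaplacian f y ^ 2 := by
  have hc : HasCompactSupport f := hasCompactSupport_of_tsupport_subset_ball hs
  have hf0 : (0 : EuclideanSpace ℝ (Fin n)) ∉ tsupport f := fun h => (hs h).2 rfl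
  set v : EuclideanSpace ℝ (Fin n) → ℝ := fun y => carlemanWeight ρ y ^ (-α) * f y with hvdef
  have hvs : tsupport v ⊆ tsupport f := tsupport_mul_subset_right
  have hv : ContDiff ℝ ∞ v := contDiff_carlemanWeight_rpow_mul hρ (-α) hf hf0
  have hfv : ∀ z, z ≠ 0 → f z = carlemanPhi (‖z‖ / ρ) ^ α * v z := fun z hz => by
    have hw := carlemanWeight_pos hρ hz
    change f z = carlemanWeight ρ z ^ α * (carlemanWeight ρ z ^ (-α) * f z)
    rw [← mul_assoc, ← Real.rpow_add hw, add_neg_cancel, Real.rpow_zero, one_mul]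
  obtain ⟨hDi, hD0⟩ := integral_carlemanDivergence ρ α hv
    (hc.of_isClosed_subset (isClosed_tsupport v) hvs) fun h => hf0 (hvs h)
  have hzero : ∀ y, y ∉ tsupport f → f y = 0 ∧ gradNormSq f y = 0 ∧ coordLaplacian f y = 0 :=
    fun y hy => by
    have h1 : ∀ i, partialDeriv i f y = 0 := fun i => image_eq_zero_of_notMem_tsupport fun h =>
      hy (tsupport_partialDeriv_subset f i h)
    exact ⟨image_eq_zero_of_notMem_tsupport hy, by simp [gradNormSq, h1],
      image_eq_zero_of_notMem_tsupport fun h => hy (tsupport_coordLaplacian_subset f h)⟩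
  have hint : ∀ (p : ℝ) (g : EuclideanSpace ℝ (Fin n) → ℝ), ContDiff ℝ ∞ g →
      (∀ y, y ∉ tsupport f → g y = 0) → Integrable fun y => carlemanWeight ρ y ^ p * g y := by
    intro p g hg hgf
    have hsub : tsupport g ⊆ tsupport f := closure_minimal
      (fun y hy => by_contra fun h => hy (hgf y h)) (isClosed_tsupport f)
    exact integrable_carlemanWeight_rpow_mul hρ p hg
      (hc.of_isClosed_subset (isClosed_tsupport g) hsub) fun h => hf0 (hsub h)
  have i1 := hint (1 - 2 * α) _ (contDiff_gradNormSq hf) fun y hy => (hzero y hy).2.1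
  have i2 := hint (-1 - 2 * α) _ (hf.pow 2) fun y hy => by simp [(hzero y hy).1]
  have i3 := hint (2 - 2 * α) _ ((contDiff_coordLaplacian hf).pow 2)
    fun y hy => by simp [(hzero y hy).2.2]
  have hL : Integrable fun y => α * ρ ^ 2 * carlemanWeight ρ y ^ (1 - 2 * α) * gradNormSq f y
      + α ^ 3 * carlemanWeight ρ y ^ (-1 - 2 * α) * f y ^ 2 := by
    refine ((i1.const_mul (α * ρ ^ 2)).add (i2.const_mul (α ^ 3))).congr (ae_of_all _ fun y => ?_)
    simp only [Pi.add_apply]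
    ring
  have hR := (i3.const_mul (900 * ρ ^ 4)).sub (hDi.const_mul (100 * ρ ^ 2))
  -- The pointwise inequality is needed only on the support of `f`, away from the origin; elsewhere
  -- both sides vanish.
  refine ⟨hL, i3, (integral_mono hL hR fun y => ?_).trans_eq ?_⟩
  · by_cases hy : y ∈ tsupport f
    · have hyρ : ‖y‖ ≤ ρ := by simpa using (Metric.mem_ball.1 (hs hy).1).le
      exact carleman_pointwise hρ hn hα hv hfv (hs hy).2 hyρ
    · have h1 : v y = 0 := image_eq_zero_of_notMem_tsupport fun h => hy (hvs h)
      have h2 : ∀ i, partialDeriv i v y = 0 := fun i => image_eq_zero_of_notMem_tsupport fun h =>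
        hy (hvs (tsupport_partialDeriv_subset v i h))
      obtain ⟨h3, h4, h5⟩ := hzero y hy
      have h6 : gradNormSq v y = 0 := by simp [gradNormSq, h2]
      simp [h3, h4, h5, h6, carlemanDivergence, rellichDivergence, h1, eulerDeriv, h2]
  · simp only [Pi.sub_apply]
    rw [integral_sub (i3.const_mul _) (hDi.const_mul _), integral_const_mul, integral_const_mul,
      hD0, mul_zero, sub_zero]

end SmoothCarleman

/-! ### Complex functions and passage to `H²` -/

section ComplexCarleman

variable {n : ℕ}

theorem partialDeriv_clm_comp {F G : Type*} [NormedAddCommGroup F] [NormedSpace ℝ F]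
    [NormedAddCommGroup G] [NormedSpace ℝ G] (L : F →L[ℝ] G) {f : EuclideanSpace ℝ (Fin n) → F}
    (hf : ContDiff ℝ ∞ f) (i : Fin n) :
    partialDeriv i (fun y => L (f y)) = fun y => L (partialDeriv i f y) := by
  funext y
  have h := L.hasFDerivAt.comp y (hf.differentiable (by simp) y).hasFDerivAt
  rw [partialDeriv, show (fun y => L (f y)) = L ∘ f from rfl, h.fderiv]
  rfl

theorem coordLaplacian_clm_comp {F G : Type*} [NormedAddCommGroup F] [NormedSpace ℝ F]
    [NormedAddCommGroup G] [NormedSpace ℝ G] (L : F →L[ℝ] G) {f : EuclideanSpace ℝ (Fin n) → F}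
    (hf : ContDiff ℝ ∞ f) (y : EuclideanSpace ℝ (Fin n)) :
    coordLaplacian (fun y => L (f y)) y = L (coordLaplacian f y) := by
  simp only [coordLaplacian, map_sum]
  refine Finset.sum_congr rfl fun i _ => ?_
  rw [partialDeriv_clm_comp L hf, partialDeriv_clm_comp L (hf.partialDeriv i)]

theorem norm_sq_eq_re_sq_add_im_sq (z : ℂ) :
    ‖z‖ ^ 2 = (Complex.reCLM z) ^ 2 + (Complex.imCLM z) ^ 2 := by
  rw [Complex.sq_norm, Complex.normSq_apply]
  simp [sq]

/-- With `V = 0` the operator is real and both sides are sums of squares, so the estimates for the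
real and imaginary parts simply add. -/
theorem carleman_of_contDiff {ρ : ℝ} (hρ : 0 < ρ) (hn : 1 ≤ n) {α : ℝ} (hα : 10 * n ≤ α)
    {f : EuclideanSpace ℝ (Fin n) → ℂ} (hf : ContDiff ℝ ∞ f)
    (hs : tsupport f ⊆ Metric.ball 0 ρ \ {0}) :
    ∫ y, (α * ρ ^ 2 * carlemanWeight ρ y ^ (1 - 2 * α) * ∑ i, ‖partialDeriv i f y‖ ^ 2
      + α ^ 3 * carlemanWeight ρ y ^ (-1 - 2 * α) * ‖f y‖ ^ 2)
    ≤ 900 * ρ ^ 4 * ∫ y, carlemanWeight ρ y ^ (2 - 2 * α) * ‖coordLaplacian f y‖ ^ 2 := by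
  have hL : ∀ L : ℂ →L[ℝ] ℝ, tsupport (fun y => L (f y)) ⊆ Metric.ball 0 ρ \ {0} := fun L =>
    (closure_mono fun y hy => by
      contrapose! hy
      simp only [Function.mem_support, not_not] at hy ⊢
      simp [hy]).trans hs
  obtain ⟨a1, a2, a3⟩ := carleman_of_real_contDiff hρ hn hα
    (Complex.reCLM.contDiff.comp hf) (hL Complex.reCLM)
  obtain ⟨b1, b2, b3⟩ := carleman_of_real_contDiff hρ hn hα
    (Complex.imCLM.contDiff.comp hf) (hL Complex.imCLM)
  have h := add_le_add a3 b3
  rw [← integral_add a1 b1, ← mul_add, ← integral_add a2 b2] at h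
  convert! h using 1
  · refine integral_congr_ae (ae_of_all _ fun y => ?_)
    simp only [gradNormSq, Function.comp_def, partialDeriv_clm_comp _ hf,
      norm_sq_eq_re_sq_add_im_sq, Finset.sum_add_distrib]
    ring
  · congr 2
    funext y
    simp only [Function.comp_def, coordLaplacian_clm_comp _ hf, norm_sq_eq_re_sq_add_im_sq]
    ring

/-- Convergence of the integrals of `F k` to the integral of `F∞` against all powers of the
Carleman weight. -/
def WeightedTendsto (ρ : ℝ) (F : ℕ → EuclideanSpace ℝ (Fin n) → ℝ)
    (F' : EuclideanSpace ℝ (Fin n) → ℝ) : Prop :=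
  ∀ p : ℝ, (∀ k, Integrable fun y => carlemanWeight ρ y ^ p * F k y) ∧
    (Integrable fun y => carlemanWeight ρ y ^ p * F' y) ∧
    Tendsto (fun k => ∫ y, carlemanWeight ρ y ^ p * F k y) atTop
      (𝓝 (∫ y, carlemanWeight ρ y ^ p * F' y))

theorem WeightedTendsto.sum {ρ : ℝ} {ι : Type*} [Fintype ι]
    {F : ι → ℕ → EuclideanSpace ℝ (Fin n) → ℝ} {F' : ι → EuclideanSpace ℝ (Fin n) → ℝ}
    (h : ∀ i, WeightedTendsto ρ (F i) (F' i)) :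
    WeightedTendsto ρ (fun k y => ∑ i, F i k y) (fun y => ∑ i, F' i y) := by
  intro p
  simp_rw [Finset.mul_sum]
  refine ⟨fun k => integrable_finsetSum _ fun i _ => (h i p).1 k,
    integrable_finsetSum _ fun i _ => (h i p).2.1, ?_⟩
  simp_rw [fun k => integral_finsetSum Finset.univ (fun i _ => (h i p).1 k),
    integral_finsetSum Finset.univ (fun i _ => (h i p).2.1)]
  exact tendsto_finsetSum _ fun i _ => (h i p).2.2

/-- The approximants stay in a fixed compact subset of the punctured ball, where every power of the
weight is continuous, hence bounded; unweighted `L²` convergence therefore suffices. -/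
theorem exists_weighted_smooth_approximation {ρ : ℝ} (hρ : 0 < ρ)
    {f : EuclideanSpace ℝ (Fin n) → ℂ} (hf : MemH 2 f)
    (hs : tsupport f ⊆ Metric.ball 0 ρ \ {0}) :
    ∃ u : ℕ → EuclideanSpace ℝ (Fin n) → ℂ, (∀ k, ContDiff ℝ ∞ (u k)) ∧
      (∀ k, tsupport (u k) ⊆ Metric.ball 0 ρ \ {0}) ∧
      (∀ᵐ x, Tendsto (fun k => u k x) atTop (𝓝 (f x))) ∧
      WeightedTendsto ρ (fun k y => ‖u k y‖ ^ 2) (fun y => ‖f y‖ ^ 2) ∧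
      WeightedTendsto ρ (fun k y => ∑ i, ‖partialDeriv i (u k) y‖ ^ 2) (weakGradSq f) ∧
      WeightedTendsto ρ (fun k y => ‖coordLaplacian (u k) y‖ ^ 2)
        (fun y => ‖weakLaplacian f y‖ ^ 2) := by
  obtain ⟨K, hK, hKU, hfK, u, hu, huK, hae, h0, h1, h2⟩ := exists_smooth_approximation hf
    (Metric.isOpen_ball.sdiff isClosed_singleton)
    (hasCompactSupport_of_tsupport_subset_ball hs) hs
  have hW : ∀ p : ℝ, ContinuousOn (fun y => carlemanWeight ρ y ^ p) K := fun p y hy =>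
    (contDiffAt_carlemanWeight_rpow hρ p (hKU hy).2).continuousAt.continuousWithinAt
  have hcomp : ∀ g : EuclideanSpace ℝ (Fin n) → ℂ, Continuous g → tsupport g ⊆ K →
      MemLp g 2 volume := fun g hg hgK =>
    hg.memLp_of_hasCompactSupport (hK.of_isClosed_subset (isClosed_tsupport g) hgK)
  have hout : ∀ g : EuclideanSpace ℝ (Fin n) → ℂ, tsupport g ⊆ K → ∀ y, y ∉ K → g y = 0 :=
    fun g hg y hy => image_eq_zero_of_notMem_tsupport fun h => hy (hg h)
  have hopen : IsOpen Kᶜ := hK.isClosed.isOpen_compl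
  have hf0 : ∀ᵐ y, y ∈ Kᶜ → f y = 0 := ae_of_all _ (hout f hfK)
  have hf1 : ∀ i, ∀ᵐ y, y ∈ Kᶜ → weakPartial i f y = 0 := fun i =>
    (hf.weakPartial i).1.ae_eq_zero hopen hf0
  have hf2 : ∀ i, ∀ᵐ y, y ∈ Kᶜ → weakPartial i (weakPartial i f) y = 0 := fun i =>
    ((hf.weakPartial i).2.weakPartial i).1.ae_eq_zero hopen (hf1 i)
  have hfl : ∀ᵐ y, y ∉ K → weakLaplacian f y = 0 := by
    filter_upwards [ae_all_iff.2 hf2] with y hy hyK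
    exact Finset.sum_eq_zero fun i _ => hy i hyK
  have hpK := fun k i => (tsupport_partialDeriv_subset (u k) i).trans (huK k)
  have hlK := fun k => (tsupport_coordLaplacian_subset (u k)).trans (huK k)
  refine ⟨u, hu, fun k => (huK k).trans hKU, hae, fun p => ?_, ?_, fun p => ?_⟩
  · exact tendsto_integral_weight_mul_norm_sq hK (hW p)
      (fun k => hcomp _ (hu k).continuous (huK k)) hf.memLp (fun k => hout _ (huK k)) hf0 h0
  · exact WeightedTendsto.sum fun i p => tendsto_integral_weight_mul_norm_sq hK (hW p)
      (fun k => hcomp _ ((hu k).partialDeriv i).continuous (hpK k i)) (hf.weakPartial i).2.memLp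
      (fun k => hout _ (hpK k i)) (hf1 i) (h1 i)
  · exact tendsto_integral_weight_mul_norm_sq hK (hW p)
      (fun k => hcomp _ (contDiff_coordLaplacian (hu k)).continuous (hlK k))
      hf.memLp_weakLaplacian (fun k => hout _ (hlK k)) hfl h2

theorem integral_carleman_left {ρ c₁ c₂ p₁ p₂ : ℝ} {F G : EuclideanSpace ℝ (Fin n) → ℝ}
    (h₁ : Integrable fun y => carlemanWeight ρ y ^ p₁ * F y)
    (h₂ : Integrable fun y => carlemanWeight ρ y ^ p₂ * G y) :
    Integrable (fun y => c₁ * carlemanWeight ρ y ^ p₁ * F y + c₂ * carlemanWeight ρ y ^ p₂ * G y) ∧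
    ∫ y, (c₁ * carlemanWeight ρ y ^ p₁ * F y + c₂ * carlemanWeight ρ y ^ p₂ * G y)
      = c₁ * (∫ y, carlemanWeight ρ y ^ p₁ * F y) + c₂ * ∫ y, carlemanWeight ρ y ^ p₂ * G y := by
  simp_rw [mul_assoc]
  refine ⟨(h₁.const_mul c₁).add (h₂.const_mul c₂), ?_⟩
  rw [integral_add (h₁.const_mul c₁) (h₂.const_mul c₂), integral_const_mul, integral_const_mul]

/-- The threshold is `10n` in dimension `n = d + 1`. Both constants are free of `ρ`. -/
theorem carlemanEstimate_zero {d : ℕ} {ρ : ℝ} (hρ : 0 < ρ) :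
    CarlemanEstimate ρ (fun _ : EuclideanSpace ℝ (Fin d) => (0 : ℝ)) (10 * (d + 1)) 900 := by
  intro α hα f hf hs
  obtain ⟨u, hu, hus, -, h0, h1, h2⟩ := exists_weighted_smooth_approximation hρ hf hs
  have hsch : ∀ y, ‖schrodinger (fun _ : EuclideanSpace ℝ (Fin d) => (0 : ℝ)) f y‖
      = ‖weakLaplacian f y‖ := fun y => by simp [schrodinger, extendPotential]
  simp only [hsch]
  obtain ⟨hi, he⟩ := integral_carleman_left (c₁ := α * ρ ^ 2) (c₂ := α ^ 3)
    (h1 (1 - 2 * α)).2.1 (h0 (-1 - 2 * α)).2.1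
  refine ⟨hi, (h2 _).2.1, ?_⟩
  rw [he]
  refine le_of_tendsto_of_tendsto' (((h1 (1 - 2 * α)).2.2.const_mul (α * ρ ^ 2)).add
    ((h0 (-1 - 2 * α)).2.2.const_mul (α ^ 3))) ((h2 (2 - 2 * α)).2.2.const_mul (900 * ρ ^ 4))
    fun k => ?_
  rw [← (integral_carleman_left ((h1 (1 - 2 * α)).1 k) ((h0 (-1 - 2 * α)).1 k)).2]
  exact carleman_of_contDiff hρ (by simp) (by push_cast; exact hα) (hu k) (hus k)

end ComplexCarleman

/-! ### Relative boundedness of admissible potentials -/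

section ClosedGraph

variable {d : ℕ}

theorem norm_toLp_sq {α : Type*} [MeasurableSpace α] {μ : Measure α} {f : α → ℂ}
    (hf : MemLp f 2 μ) : ‖hf.toLp f‖ ^ 2 = ∫ x, ‖f x‖ ^ 2 ∂μ := by
  rw [Lp.norm_toLp, integral_norm_sq_eq_toReal hf.aestronglyMeasurable, ← ENNReal.toReal_pow]
  congr 1
  have h := eLpNorm_nnreal_pow_eq_lintegral (f := f) (μ := μ) (p := 2) (by simp)
  simpa using h

theorem exists_clm_integral_smul {α : Type*} [MeasurableSpace α] {μ : Measure α} {η : α → ℝ}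
    (hη : MemLp η 2 μ) : ∃ T : Lp ℂ 2 μ →L[ℝ] ℂ, ∀ f : Lp ℂ 2 μ, T f = ∫ y, η y • f y ∂μ := by
  have hη' : MemLp (fun y => (η y : ℂ)) 2 μ := hη.ofReal
  refine ⟨(innerSL ℂ (hη'.toLp _)).restrictScalars ℝ, fun f => ?_⟩
  rw [ContinuousLinearMap.coe_restrictScalars', innerSL_apply_apply, L2.inner_def]
  refine integral_congr_ae (hη'.coeFn_toLp.mono fun y hy => ?_)
  simp only [hy, RCLike.inner_apply, Complex.conj_ofReal, Complex.real_smul]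
  ring

/-- The space `L²(ℝᵈ)`. -/
noncomputable abbrev L2Space (d : ℕ) := Lp ℂ 2 (volume : Measure (EuclideanSpace ℝ (Fin d)))

/-- The Sobolev space `H¹(ℝᵈ)` as the space of pairs of a function and its weak gradient. -/
noncomputable def sobolevGraph (d : ℕ) :
    Submodule ℝ (L2Space d × (Fin d → L2Space d)) :=
  ⨅ (i : Fin d) (T : L2Space d →L[ℝ] ℂ) (T' : L2Space d →L[ℝ] ℂ)
    (_ : ∃ η : EuclideanSpace ℝ (Fin d) → ℝ, ContDiff ℝ ∞ η ∧ HasCompactSupport η ∧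
      (∀ f, T f = ∫ y, partialDeriv i η y • f y) ∧ ∀ f, T' f = ∫ y, η y • f y),
    LinearMap.ker ((T ∘L ContinuousLinearMap.fst ℝ _ _) + (T' ∘L ContinuousLinearMap.proj i ∘L
      ContinuousLinearMap.snd ℝ _ _) : _ →L[ℝ] ℂ).toLinearMap

/-- Immediate because the weak-derivative condition is phrased through continuous functionals: the
graph is an intersection of their kernels. This supplies the completeness of `H¹` for the closed
graph theorem. -/
theorem isClosed_sobolevGraph (d : ℕ) :
    IsClosed (sobolevGraph d : Set (L2Space d × (Fin d → L2Space d))) := by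
  simp only [sobolevGraph, Submodule.coe_iInf]
  exact isClosed_iInter fun i => isClosed_iInter fun T => isClosed_iInter fun T' =>
    isClosed_iInter fun _ => ContinuousLinearMap.isClosed_ker _

theorem mem_sobolevGraph_iff (p : L2Space d × (Fin d → L2Space d)) :
    p ∈ sobolevGraph d ↔ ∀ i, HasWeakPartial i p.1 (p.2 i) := by
  have hloc : ∀ f : L2Space d,
      LocallyIntegrable f volume := fun f => (Lp.memLp f).locallyIntegrable (by norm_num)
  simp only [sobolevGraph, Submodule.mem_iInf]
  constructor
  · refine fun h i => ⟨hloc _, hloc _, fun η hη hc => ?_⟩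
    have hc' : HasCompactSupport (partialDeriv i η) :=
      hc.of_isClosed_subset (isClosed_tsupport _) (tsupport_partialDeriv_subset η i)
    obtain ⟨T, hT⟩ := exists_clm_integral_smul
      ((hη.partialDeriv i).continuous.memLp_of_hasCompactSupport (p := 2) (μ := volume) hc')
    obtain ⟨T', hT'⟩ := exists_clm_integral_smul
      (hη.continuous.memLp_of_hasCompactSupport (p := 2) (μ := volume) hc)
    have h1 := h i T T' ⟨η, hη, hc, hT, hT'⟩
    have h2 : T p.1 + T' (p.2 i) = 0 := h1
    rw [hT, hT'] at h2
    exact eq_neg_of_add_eq_zero_left h2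
  · rintro h i T T' ⟨η, hη, hc, hT, hT'⟩
    change T p.1 + T' (p.2 i) = 0
    rw [hT, hT']
    exact add_eq_zero_iff_eq_neg.2 ((h i).2.2 η hη hc)

theorem memH_one_of_mem_sobolevGraph {p : L2Space d × (Fin d → L2Space d)} (hp : p ∈ sobolevGraph d) :
    MemH 1 p.1 :=
  ⟨Lp.memLp p.1, fun i => ⟨p.2 i, (mem_sobolevGraph_iff p).1 hp i, Lp.memLp (p.2 i)⟩⟩

/-- Multiplication of an element of `H¹` by an admissible potential. -/
noncomputable def Admissible.mul {V : EuclideanSpace ℝ (Fin d) → ℝ} (hV : Admissible V)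
    (p : sobolevGraph d) : L2Space d :=
  (hV.2 p.1.1 (memH_one_of_mem_sobolevGraph p.2)).toLp _

theorem Admissible.coeFn_mul {V : EuclideanSpace ℝ (Fin d) → ℝ} (hV : Admissible V)
    (p : sobolevGraph d) : hV.mul p =ᵐ[volume] fun x => (V x : ℂ) * p.1.1 x :=
  (hV.2 p.1.1 (memH_one_of_mem_sobolevGraph p.2)).coeFn_toLp

/-- Multiplication by an admissible potential, as a linear map `H¹ → L²`. -/
noncomputable def Admissible.mulOperator {V : EuclideanSpace ℝ (Fin d) → ℝ} (hV : Admissible V) :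
    sobolevGraph d →ₗ[ℝ] L2Space d where
  toFun := hV.mul
  map_add' p q := by
    refine Lp.ext ?_
    filter_upwards [Lp.coeFn_add p.1.1 q.1.1, Lp.coeFn_add (hV.mul p) (hV.mul q), hV.coeFn_mul p,
      hV.coeFn_mul q, hV.coeFn_mul (p + q)] with x h1 h2 h3 h4 h5
    rw [h5, h2, Pi.add_apply, h3, h4, ← mul_add]
    exact congrArg _ h1
  map_smul' c p := by
    refine Lp.ext ?_
    filter_upwards [Lp.coeFn_smul c p.1.1, Lp.coeFn_smul c (hV.mul p), hV.coeFn_mul p,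
      hV.coeFn_mul (c • p)] with x h1 h2 h3 h4
    rw [RingHom.id_apply, h4, h2, Pi.smul_apply, h3, ← mul_smul_comm]
    exact congrArg _ h1

/-- Closed graph theorem. If `u_k → x` in `H¹` and `V u_k → y` in `L²`, then both converge almost
everywhere along a common subsequence, and there `V u_k → V x`, so `y = V x`. -/
theorem Admissible.continuous_mulOperator {V : EuclideanSpace ℝ (Fin d) → ℝ}
    (hV : Admissible V) : Continuous hV.mulOperator := by
  have : CompleteSpace (sobolevGraph d) := (isClosed_sobolevGraph d).completeSpace_coe
  refine hV.mulOperator.continuous_of_seq_closed_graph fun u x y hux huy => ?_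
  have h1 : Tendsto (fun k => (u k).1.1) atTop (𝓝 x.1.1) :=
    ((continuous_fst.comp continuous_subtype_val).tendsto x).comp hux
  obtain ⟨s, hs, hs1⟩ := (tendstoInMeasure_of_tendsto_Lp h1).exists_seq_tendsto_ae
  -- Extracted from the first subsequence, so that both almost-everywhere limits hold along it.
  obtain ⟨t, ht, ht1⟩ := (tendstoInMeasure_of_tendsto_Lp
    (huy.comp hs.tendsto_atTop)).exists_seq_tendsto_ae
  have h2 : ∀ᵐ z, ∀ k, hV.mulOperator (u k) z = (V z : ℂ) * (u k).1.1 z :=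
    ae_all_iff.2 fun k => hV.coeFn_mul (u k)
  have h3 : ∀ᵐ z, hV.mulOperator x z = (V z : ℂ) * x.1.1 z :=
    hV.coeFn_mul x
  refine Lp.ext ?_
  filter_upwards [hs1, ht1, h2, h3] with z a b c e
  refine tendsto_nhds_unique b ?_
  simp only [Function.comp_apply, c, e]
  exact (a.comp ht.tendsto_atTop).const_mul _

/-- The product carries the sup norm, which is dominated by the Euclidean one; no dimensional
constant is lost. -/
theorem norm_sq_prod_pi_le {ι E F : Type*} [Fintype ι] [NormedAddCommGroup E]
    [NormedAddCommGroup F] (p : E × (ι → F)) : ‖p‖ ^ 2 ≤ ∑ i, ‖p.2 i‖ ^ 2 + ‖p.1‖ ^ 2 := by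
  have hS : 0 ≤ ∑ i, ‖p.2 i‖ ^ 2 := by positivity
  have hle : ‖p‖ ≤ Real.sqrt (∑ i, ‖p.2 i‖ ^ 2 + ‖p.1‖ ^ 2) := by
    refine norm_prod_le_iff.2 ⟨Real.le_sqrt_of_sq_le (by linarith), ?_⟩
    refine (pi_norm_le_iff_of_nonneg (Real.sqrt_nonneg _)).2 fun i => Real.le_sqrt_of_sq_le ?_
    have := Finset.single_le_sum (f := fun i => ‖p.2 i‖ ^ 2)
      (fun i _ => sq_nonneg _) (Finset.mem_univ i)
    nlinarith [sq_nonneg ‖p.1‖]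
  calc ‖p‖ ^ 2 ≤ _ := pow_le_pow_left₀ (norm_nonneg _) hle 2
    _ = _ := Real.sq_sqrt (by positivity)

theorem norm_L2Space_sq (f : L2Space d) : ‖f‖ ^ 2 = ∫ x, ‖f x‖ ^ 2 := by
  have := norm_toLp_sq (Lp.memLp f)
  rwa [Lp.toLp_coeFn] at this

theorem Admissible.exists_formBound {V : EuclideanSpace ℝ (Fin d) → ℝ} (hV : Admissible V) :
    ∃ l₁ l₂ : ℝ, 0 ≤ l₁ ∧ 0 ≤ l₂ ∧ FormBound V l₁ l₂ := by
  obtain ⟨c, hc0, hc⟩ : ∃ c : ℝ, 0 ≤ c ∧ ∀ p, ‖hV.mul p‖ ≤ c * ‖p‖ :=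
    let A : sobolevGraph d →L[ℝ] L2Space d := ⟨hV.mulOperator, hV.continuous_mulOperator⟩
    ⟨‖A‖, norm_nonneg A, A.le_opNorm⟩
  -- `c` is the operator norm of multiplication by `V` from `H¹` to `L²`.
  refine ⟨c ^ 2, c ^ 2, sq_nonneg _, sq_nonneg _, fun ψ hψ => ?_⟩
  have hg : ∀ i, MemLp (_root_.weakPartial i ψ) 2 volume := fun i => (hψ.weakPartial i).2
  obtain ⟨p, hp1, hp2⟩ : ∃ p : L2Space d × (Fin d → L2Space d), p.1 = hψ.1.toLp ψ ∧
    ∀ i, p.2 i = (hg i).toLp _ := ⟨(hψ.1.toLp ψ, fun i => (hg i).toLp _), rfl, fun _ => rfl⟩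
  have hp : p ∈ sobolevGraph d := (mem_sobolevGraph_iff p).2 fun i => by
    rw [hp1, hp2]
    exact (hψ.weakPartial i).1.congr hψ.1.coeFn_toLp.symm (hg i).coeFn_toLp.symm
  have hA : ‖hV.mul ⟨p, hp⟩‖ ^ 2 = ∫ x, ‖(V x : ℂ) * ψ x‖ ^ 2 := by
    rw [norm_L2Space_sq]
    refine integral_congr_ae ?_
    have h1 : p.1 =ᵐ[volume] ψ := hp1 ▸ hψ.1.coeFn_toLp
    filter_upwards [hV.coeFn_mul ⟨p, hp⟩, h1] with x h2 h3
    rw [h2, h3]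
  have hgrad : ∫ x, weakGradSq ψ x = ∑ i, ‖p.2 i‖ ^ 2 := by
    simp only [weakGradSq, hp2, norm_toLp_sq]
    exact integral_finsetSum _ fun i _ => (hg i).integrable_norm_pow (p := 2) (by simp)
  rw [← hA, hgrad, ← norm_toLp_sq hψ.1, ← hp1, ← mul_add]
  calc _ ≤ (c * ‖p‖) ^ 2 := pow_le_pow_left₀ (norm_nonneg _) (hc ⟨p, hp⟩) 2
    _ = c ^ 2 * ‖p‖ ^ 2 := mul_pow _ _ _
    _ ≤ _ := by gcongr; exact norm_sq_prod_pi_le p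

end ClosedGraph

/-! ### Slicing `ℝᵈ⁺¹` and the extended potential -/

section Slices

variable {d : ℕ}

/-- The isometric embedding `x ↦ (x, t)` of `ℝᵈ` into `ℝᵈ⁺¹`. -/
noncomputable def sliceEmbedding (t : ℝ) (x : EuclideanSpace ℝ (Fin d)) :
    EuclideanSpace ℝ (Fin (d + 1)) :=
  WithLp.toLp 2 (Fin.snoc (α := fun _ => ℝ) x t)

@[simp]
theorem sliceEmbedding_castSucc (t : ℝ) (x : EuclideanSpace ℝ (Fin d)) (i : Fin d) :
    sliceEmbedding t x i.castSucc = x i := by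
  simp [sliceEmbedding]

@[simp]
theorem sliceEmbedding_last (t : ℝ) (x : EuclideanSpace ℝ (Fin d)) :
    sliceEmbedding t x (Fin.last d) = t := by
  simp [sliceEmbedding]

theorem extendPotential_sliceEmbedding (V : EuclideanSpace ℝ (Fin d) → ℝ) (t : ℝ)
    (x : EuclideanSpace ℝ (Fin d)) : extendPotential V (sliceEmbedding t x) = V x := by
  simp only [extendPotential, sliceEmbedding_castSucc]

theorem isometry_sliceEmbedding (t : ℝ) : Isometry (sliceEmbedding (d := d) t) := by
  refine Isometry.of_dist_eq fun x y => ?_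
  simp [EuclideanSpace.dist_eq, Fin.sum_univ_castSucc]

theorem contDiff_sliceEmbedding (t : ℝ) : ContDiff ℝ ∞ (sliceEmbedding (d := d) t) := by
  rw [contDiff_euclidean]
  intro i
  refine Fin.lastCases ?_ (fun j => ?_) i
  · simpa using contDiff_const
  · simpa using contDiff_coord j

theorem sliceEmbedding_add_smul_single (t s : ℝ) (x : EuclideanSpace ℝ (Fin d)) (i : Fin d) :
    sliceEmbedding t (x + s • EuclideanSpace.single i (1 : ℝ))
      = sliceEmbedding t x + s • EuclideanSpace.single i.castSucc (1 : ℝ) := by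
  ext j
  refine Fin.lastCases ?_ (fun k => ?_) j
  · simp [(Fin.castSucc_lt_last i).ne']
  · simp [Fin.castSucc_inj]

theorem partialDeriv_comp_sliceEmbedding {f : EuclideanSpace ℝ (Fin (d + 1)) → ℂ}
    (hf : ContDiff ℝ ∞ f) (t : ℝ) (i : Fin d) (x : EuclideanSpace ℝ (Fin d)) :
    partialDeriv i (fun x => f (sliceEmbedding t x)) x
      = partialDeriv i.castSucc f (sliceEmbedding t x) := by
  have hd := (hf.differentiable (by simp) (sliceEmbedding t x))
  have hs : DifferentiableAt ℝ (fun x => f (sliceEmbedding t x)) x :=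
    (hf.comp (contDiff_sliceEmbedding t)).differentiable (by simp) x
  have h1 := hs.lineDeriv_eq_fderiv (v := EuclideanSpace.single i (1 : ℝ))
  have h2 := hd.lineDeriv_eq_fderiv (v := EuclideanSpace.single i.castSucc (1 : ℝ))
  rw [partialDeriv, partialDeriv, ← h1, ← h2, lineDeriv, lineDeriv]
  simp only [sliceEmbedding_add_smul_single]

/-- The identification of `ℝᵈ × ℝ` with `ℝᵈ⁺¹`. -/
noncomputable def sliceEquiv (d : ℕ) :
    EuclideanSpace ℝ (Fin d) × ℝ ≃ᵐ EuclideanSpace ℝ (Fin (d + 1)) :=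
  ((MeasurableEquiv.prodCongr (MeasurableEquiv.toLp 2 (Fin d → ℝ)).symm
    (MeasurableEquiv.refl ℝ)).trans MeasurableEquiv.prodComm).trans
    ((MeasurableEquiv.piFinSuccAbove (fun _ => ℝ) (Fin.last d)).symm.trans
      (MeasurableEquiv.toLp 2 (Fin (d + 1) → ℝ)))

theorem sliceEquiv_apply (p : EuclideanSpace ℝ (Fin d) × ℝ) :
    sliceEquiv d p = sliceEmbedding p.2 p.1 := by
  simp only [sliceEquiv, sliceEmbedding, MeasurableEquiv.trans_apply]
  change WithLp.toLp 2 (Fin.insertNth (α := fun _ => ℝ) (Fin.last d) p.2 p.1.ofLp) = _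
  rw [Fin.insertNth_last']

theorem measurePreserving_sliceEquiv (d : ℕ) :
    MeasurePreserving (sliceEquiv d) volume volume := by
  have h1 : MeasurePreserving (MeasurableEquiv.prodCongr (MeasurableEquiv.toLp 2 (Fin d → ℝ)).symm
      (MeasurableEquiv.refl ℝ)) volume volume :=
    (PiLp.volume_preserving_ofLp (Fin d)).prod (MeasurePreserving.id volume)
  have h2 : MeasurePreserving (MeasurableEquiv.prodComm : (Fin d → ℝ) × ℝ ≃ᵐ ℝ × (Fin d → ℝ))
      volume volume := Measure.measurePreserving_swap
  have h3 := (volume_preserving_piFinSuccAbove (fun _ : Fin (d + 1) => ℝ) (Fin.last d)).symm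
  have h4 := PiLp.volume_preserving_toLp (Fin (d + 1))
  exact h4.comp (h3.comp (h2.comp h1))

theorem aemeasurable_extendPotential {V : EuclideanSpace ℝ (Fin d) → ℝ}
    (hV : AEMeasurable V volume) : AEMeasurable (extendPotential V) volume := by
  have h1 : AEMeasurable (fun p : EuclideanSpace ℝ (Fin d) × ℝ => V p.1) volume := hV.comp_fst
  have h2 := h1.comp_quasiMeasurePreserving
    (measurePreserving_sliceEquiv d).symm.quasiMeasurePreserving
  convert h2 using 1
  funext y
  obtain ⟨p, rfl⟩ := (sliceEquiv d).surjective y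
  simp [sliceEquiv_apply, extendPotential_sliceEmbedding]
  rw [← sliceEquiv_apply, MeasurableEquiv.symm_apply_apply]

theorem lintegral_eq_lintegral_slices {F : EuclideanSpace ℝ (Fin (d + 1)) → ENNReal}
    (hF : AEMeasurable F volume) :
    ∫⁻ y, F y = ∫⁻ t : ℝ, ∫⁻ x : EuclideanSpace ℝ (Fin d), F (sliceEmbedding t x) := by
  rw [← (measurePreserving_sliceEquiv d).lintegral_comp_emb (sliceEquiv d).measurableEmbedding F]
  have h : AEMeasurable (fun p => F (sliceEquiv d p)) volume :=
    hF.comp_quasiMeasurePreserving (measurePreserving_sliceEquiv d).quasiMeasurePreserving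
  rw [Measure.volume_eq_prod] at h ⊢
  rw [lintegral_prod_symm _ h]
  simp only [sliceEquiv_apply]

/-- On each slice of constant last coordinate the extended potential is `V`, so the form bound
applies to the restriction of `f`; Tonelli integrates over slices. Only the first `d` derivatives
occur, and the last one is added for free. The lower integral is used because integrability of the
left-hand side is not known in advance. -/
theorem lintegral_extendPotential_mul_le {V : EuclideanSpace ℝ (Fin d) → ℝ} (hV : Admissible V)
    {l₁ l₂ : ℝ} (hl₁ : 0 ≤ l₁) (hl₂ : 0 ≤ l₂) (hfb : FormBound V l₁ l₂)
    {f : EuclideanSpace ℝ (Fin (d + 1)) → ℂ} (hf : ContDiff ℝ ∞ f) (hc : HasCompactSupport f) :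
    ∫⁻ y, ‖(extendPotential V y : ℂ) * f y‖ₑ ^ 2
      ≤ ENNReal.ofReal (∫ y, (l₁ * ∑ i, ‖partialDeriv i f y‖ ^ 2 + l₂ * ‖f y‖ ^ 2)) := by
  set Q : EuclideanSpace ℝ (Fin (d + 1)) → ℝ := fun y =>
    l₁ * ∑ i : Fin d, ‖partialDeriv i.castSucc f y‖ ^ 2 + l₂ * ‖f y‖ ^ 2 with hQ
  set Q' : EuclideanSpace ℝ (Fin (d + 1)) → ℝ := fun y =>
    l₁ * ∑ i, ‖partialDeriv i f y‖ ^ 2 + l₂ * ‖f y‖ ^ 2 with hQ'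
  have hQ0 : ∀ y, 0 ≤ Q y := fun y => by positivity
  have hQQ : ∀ y, Q y ≤ Q' y := fun y => by
    simp only [Q, Q', Fin.sum_univ_castSucc]
    nlinarith [sq_nonneg ‖partialDeriv (Fin.last d) f y‖]
  have hcont : ∀ i, Continuous (partialDeriv i f) := fun i => (hf.partialDeriv i).continuous
  have hQc : Continuous Q := by have := hf.continuous; fun_prop
  have hQ'c : Continuous Q' := by have := hf.continuous; fun_prop
  have hzero : ∀ y, y ∉ tsupport f → f y = 0 ∧ ∀ i, partialDeriv i f y = 0 := fun y hy =>
    ⟨image_eq_zero_of_notMem_tsupport hy, fun i => image_eq_zero_of_notMem_tsupport fun h =>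
      hy (tsupport_partialDeriv_subset f i h)⟩
  have hQs : HasCompactSupport Q := HasCompactSupport.intro hc fun y hy => by
    simp [Q, hzero y hy]
  have hQ's : HasCompactSupport Q' := HasCompactSupport.intro hc fun y hy => by
    simp [Q', hzero y hy]
  have hslice : ∀ t : ℝ, ∫⁻ x, ‖(extendPotential V (sliceEmbedding t x) : ℂ)
      * f (sliceEmbedding t x)‖ₑ ^ 2 ≤ ∫⁻ x, ENNReal.ofReal (Q (sliceEmbedding t x)) := fun t => by
    have hs : ContDiff ℝ ∞ (fun x => f (sliceEmbedding t x)) :=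
      hf.comp (contDiff_sliceEmbedding t)
    have hemb := (isometry_sliceEmbedding (d := d) t).isClosedEmbedding
    have hsc : HasCompactSupport (fun x => f (sliceEmbedding t x)) :=
      hc.comp_isClosedEmbedding hemb
    have hM := memH_one_of_contDiff hs hsc
    have hmem := hV.2 _ hM
    have hb := hfb _ hM
    simp only [extendPotential_sliceEmbedding]
    have h1 : ∫⁻ x, ‖(V x : ℂ) * f (sliceEmbedding t x)‖ₑ ^ 2
        = ENNReal.ofReal (∫ x, ‖(V x : ℂ) * f (sliceEmbedding t x)‖ ^ 2) := by
      rw [integral_norm_sq_eq_toReal hmem.aestronglyMeasurable, ENNReal.ofReal_toReal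
        ((memLp_two_iff_lintegral hmem.aestronglyMeasurable).1 hmem).ne]
    have hQi : Integrable (fun x => Q (sliceEmbedding t x)) :=
      (hQc.comp hemb.continuous).integrable_of_hasCompactSupport (hQs.comp_isClosedEmbedding hemb)
    rw [h1, ← ofReal_integral_eq_lintegral_ofReal hQi (ae_of_all _ fun x => hQ0 _)]
    refine ENNReal.ofReal_le_ofReal (hb.trans_eq ?_)
    rw [integral_congr_ae (weakGradSq_ae_eq_of_contDiff hs), ← integral_const_mul,
      ← integral_const_mul, ← integral_add]
    · simp only [partialDeriv_comp_sliceEmbedding hf, Q]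
    · refine Integrable.const_mul (integrable_finsetSum _ fun i _ => ?_) _
      exact ((hs.partialDeriv i).continuous.memLp_of_hasCompactSupport (p := 2)
        (hsc.of_isClosed_subset (isClosed_tsupport _)
          (tsupport_partialDeriv_subset _ i))).integrable_norm_pow (by simp)
    · exact (hM.1.integrable_norm_pow (p := 2) (by simp)).const_mul _
  have hVm : AEMeasurable (fun y => (extendPotential V y : ℂ)) volume :=
    (Complex.measurable_ofReal.comp_aemeasurable (aemeasurable_extendPotential hV.1))
  have hm : AEMeasurable (fun y => ‖(extendPotential V y : ℂ) * f y‖ₑ ^ 2) volume :=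
    (hVm.mul hf.continuous.aemeasurable).enorm.pow_const 2
  rw [lintegral_eq_lintegral_slices hm]
  calc _ ≤ ∫⁻ t, ∫⁻ x, ENNReal.ofReal (Q (sliceEmbedding t x)) := lintegral_mono hslice
    _ = ∫⁻ y, ENNReal.ofReal (Q y) :=
      (lintegral_eq_lintegral_slices hQc.measurable.ennreal_ofReal.aemeasurable).symm
    _ ≤ ∫⁻ y, ENNReal.ofReal (Q' y) := lintegral_mono fun y => ENNReal.ofReal_le_ofReal (hQQ y)
    _ = _ := (ofReal_integral_eq_lintegral_ofReal
      (hQ'c.integrable_of_hasCompactSupport hQ's)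
      (ae_of_all _ fun y => (hQ0 y).trans (hQQ y))).symm

end Slices

/-! ### Absorbing the potential -/

section Potential

variable {n d : ℕ}

theorem partialDeriv_carlemanWeight_rpow_smul {ρ : ℝ} (hρ : 0 < ρ) (p : ℝ)
    {f : EuclideanSpace ℝ (Fin n) → ℂ} (hf : ContDiff ℝ ∞ f) {y : EuclideanSpace ℝ (Fin n)}
    (hy : y ≠ 0) (i : Fin n) :
    partialDeriv i (fun y => carlemanWeight ρ y ^ p • f y) y
      = carlemanWeight ρ y ^ p • (partialDeriv i f y
        + (p * Real.exp (-(‖y‖ / ρ)) / ‖y‖ ^ 2 * y i) • f y) := by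
  have hr := norm_pos_iff.2 hy
  obtain ⟨hd, he⟩ := partialDeriv_radial hy (hasDerivAt_carlemanPhi_div_rpow hρ p hr) i
  have h := fderiv_fun_smul hd (hf.differentiable (by simp) y)
  change fderiv ℝ (fun y => carlemanPhi (‖y‖ / ρ) ^ p • f y) y _ = _
  rw [h]
  simp only [add_apply, smul_apply,
    ContinuousLinearMap.smulRight_apply]
  rw [partialDeriv] at he
  rw [he, smul_add, smul_smul]
  congr 2
  change _ = carlemanPhi (‖y‖ / ρ) ^ p * _
  field_simp

/-- The product rule gives `w^{1-α}(∇f + (1-α) q |y|^{-2} f y)` with `0 < q ≤ 1`. For `α ≥ 1` one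
has `(1-α)² ≤ α²`, and `w ≤ |y|/ρ` gives `|y|^{-2} ≤ ρ^{-2}w^{-2}`. Finally `w ≤ 1` on the ball
allows each exponent of `w` to be lowered by one to match the Carleman estimate. -/
theorem sum_norm_partialDeriv_carlemanWeight_le {ρ : ℝ} (hρ : 0 < ρ) {α : ℝ} (hα : 1 ≤ α)
    {f : EuclideanSpace ℝ (Fin n) → ℂ} (hf : ContDiff ℝ ∞ f) {y : EuclideanSpace ℝ (Fin n)}
    (hy : y ≠ 0) (hyρ : ‖y‖ ≤ ρ) :
    ∑ i, ‖partialDeriv i (fun y => carlemanWeight ρ y ^ (1 - α) • f y) y‖ ^ 2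
      ≤ 2 * (carlemanWeight ρ y ^ (1 - 2 * α) * ∑ i, ‖partialDeriv i f y‖ ^ 2)
        + 2 * α ^ 2 / ρ ^ 2 * (carlemanWeight ρ y ^ (-1 - 2 * α) * ‖f y‖ ^ 2) := by
  have hr := norm_pos_iff.2 hy
  have hw := carlemanWeight_pos hρ hy
  have hw1 := carlemanWeight_le hρ y
  have hwone : carlemanWeight ρ y ≤ 1 := hw1.trans (div_le_one_of_le₀ hyρ hρ.le)
  have h := fun i => partialDeriv_carlemanWeight_rpow_smul hρ (1 - α) hf hy i
  set w := carlemanWeight ρ y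
  set q := Real.exp (-(‖y‖ / ρ))
  have hq0 : 0 < q := Real.exp_pos _
  have hq1 : q ≤ 1 := Real.exp_le_one_iff.2 (by have := div_pos hr hρ; linarith)
  have hsq : (w ^ (1 - α)) ^ 2 = w ^ (2 - 2 * α) := by
    rw [← Real.rpow_natCast, ← Real.rpow_mul hw.le]
    congr 1
    push_cast
    ring
  have hterm : ∀ i, ‖partialDeriv i (fun y => carlemanWeight ρ y ^ (1 - α) • f y) y‖ ^ 2
      ≤ w ^ (2 - 2 * α) * (2 * ‖partialDeriv i f y‖ ^ 2
        + 2 * ((1 - α) * q / ‖y‖ ^ 2) ^ 2 * ‖f y‖ ^ 2 * (y i * y i)) := fun i => by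
    rw [h i, norm_smul, mul_pow, Real.norm_eq_abs, sq_abs, hsq]
    refine mul_le_mul_of_nonneg_left ?_ (Real.rpow_nonneg hw.le _)
    have h1 := norm_add_le (partialDeriv i f y) (((1 - α) * q / ‖y‖ ^ 2 * y i) • f y)
    have h2 : ‖((1 - α) * q / ‖y‖ ^ 2 * y i) • f y‖ ^ 2
        = ((1 - α) * q / ‖y‖ ^ 2) ^ 2 * ‖f y‖ ^ 2 * (y i * y i) := by
      rw [norm_smul, mul_pow, Real.norm_eq_abs, sq_abs]; ring
    have h3 := pow_le_pow_left₀ (norm_nonneg _) h1 2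
    nlinarith [sq_nonneg (‖partialDeriv i f y‖ - ‖((1 - α) * q / ‖y‖ ^ 2 * y i) • f y‖)]
  refine (Finset.sum_le_sum fun i _ => hterm i).trans ?_
  rw [← Finset.mul_sum, Finset.sum_add_distrib, ← Finset.mul_sum, ← Finset.mul_sum, sum_sq_coord,
    mul_add]
  refine add_le_add ?_ ?_
  · rw [mul_left_comm]
    gcongr ?_ * (?_ * ?_)
    exact Real.rpow_le_rpow_of_exponent_ge hw hwone (by linarith)
  · have h1 : ((1 - α) * q) ^ 2 ≤ α ^ 2 := by
      rw [mul_pow]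
      have : (1 - α) ^ 2 ≤ α ^ 2 := by nlinarith
      calc _ ≤ α ^ 2 * 1 := by gcongr; exact pow_le_one₀ hq0.le hq1
        _ = _ := mul_one _
    have h2 : 1 / ‖y‖ ^ 2 ≤ 1 / ρ ^ 2 * (1 / w ^ 2) := by
      rw [le_div_iff₀ hρ] at hw1
      rw [one_div_mul_one_div, ← mul_pow]
      exact one_div_le_one_div_of_le (by positivity)
        (pow_le_pow_left₀ (by positivity) (by linarith) 2)
    have h3 : w ^ (2 - 2 * α) * (1 / w ^ 2) = w ^ (-2 * α) := by
      rw [one_div, ← Real.rpow_natCast, ← Real.rpow_neg hw.le, ← Real.rpow_add hw]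
      congr 1
      push_cast
      ring
    have h4 : w ^ (-2 * α) ≤ w ^ (-1 - 2 * α) :=
      Real.rpow_le_rpow_of_exponent_ge hw hwone (by linarith)
    calc _ = 2 * ((1 - α) * q) ^ 2 * (w ^ (2 - 2 * α) * (1 / ‖y‖ ^ 2)) * ‖f y‖ ^ 2 := by
          field_simp
      _ ≤ 2 * α ^ 2 * (w ^ (2 - 2 * α) * (1 / ρ ^ 2 * (1 / w ^ 2))) * ‖f y‖ ^ 2 := by gcongr
      _ = 2 * α ^ 2 / ρ ^ 2 * (w ^ (2 - 2 * α) * (1 / w ^ 2) * ‖f y‖ ^ 2) := by ring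
      _ ≤ _ := by rw [h3]; gcongr

theorem lintegral_weighted_potential_le {V : EuclideanSpace ℝ (Fin d) → ℝ} (hV : Admissible V)
    {l₁ l₂ : ℝ} (hl₁ : 0 ≤ l₁) (hl₂ : 0 ≤ l₂) (hfb : FormBound V l₁ l₂) {ρ : ℝ} (hρ : 0 < ρ)
    {α : ℝ} (hα : 1 ≤ α) {f : EuclideanSpace ℝ (Fin (d + 1)) → ℂ} (hf : ContDiff ℝ ∞ f)
    (hs : tsupport f ⊆ Metric.ball 0 ρ \ {0})
    (hi₁ : Integrable fun y => carlemanWeight ρ y ^ (1 - 2 * α) * ∑ i, ‖partialDeriv i f y‖ ^ 2)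
    (hi₀ : Integrable fun y => carlemanWeight ρ y ^ (-1 - 2 * α) * ‖f y‖ ^ 2) :
    ∫⁻ y, ‖(extendPotential V y : ℂ) * (carlemanWeight ρ y ^ (1 - α) • f y)‖ₑ ^ 2
      ≤ ENNReal.ofReal (
        2 * l₁ * (∫ y, carlemanWeight ρ y ^ (1 - 2 * α) * ∑ i, ‖partialDeriv i f y‖ ^ 2)
        + (2 * l₁ * α ^ 2 / ρ ^ 2 + l₂)
          * ∫ y, carlemanWeight ρ y ^ (-1 - 2 * α) * ‖f y‖ ^ 2) := by
  have hc : HasCompactSupport f := hasCompactSupport_of_tsupport_subset_ball hs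
  have hf0 : (0 : EuclideanSpace ℝ (Fin (d + 1))) ∉ tsupport f := fun h => (hs h).2 rfl
  have hsub : tsupport (fun y => carlemanWeight ρ y ^ (1 - α) • f y) ⊆ tsupport f :=
    tsupport_smul_subset_right _ f
  refine (lintegral_extendPotential_mul_le hV hl₁ hl₂ hfb
    (contDiff_carlemanWeight_rpow_mul hρ (1 - α) hf hf0)
    (hc.of_isClosed_subset (isClosed_tsupport _) hsub)).trans (ENNReal.ofReal_le_ofReal ?_)
  rw [← integral_const_mul, ← integral_const_mul,
    ← integral_add (hi₁.const_mul _) (hi₀.const_mul _)]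
  refine integral_mono_of_nonneg (ae_of_all _ fun y => by positivity)
    ((hi₁.const_mul _).add (hi₀.const_mul _)) (ae_of_all _ fun y => ?_)
  by_cases hy : y ∈ tsupport f
  · have hy0 : y ≠ 0 := (hs hy).2
    have hyρ : ‖y‖ ≤ ρ := by simpa using (Metric.mem_ball.1 (hs hy).1).le
    have hw := carlemanWeight_pos hρ hy0
    have h1 := sum_norm_partialDeriv_carlemanWeight_le hρ hα hf hy0 hyρ
    have h2 : ‖carlemanWeight ρ y ^ (1 - α) • f y‖ ^ 2
        ≤ carlemanWeight ρ y ^ (-1 - 2 * α) * ‖f y‖ ^ 2 := by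
      rw [norm_smul, mul_pow, Real.norm_eq_abs, sq_abs, ← Real.rpow_natCast, ← Real.rpow_mul hw.le]
      refine mul_le_mul_of_nonneg_right (Real.rpow_le_rpow_of_exponent_ge hw
        ((carlemanWeight_le hρ y).trans (div_le_one_of_le₀ hyρ hρ.le)) ?_) (sq_nonneg _)
      push_cast
      linarith
    have h3 := add_le_add (mul_le_mul_of_nonneg_left h1 hl₁) (mul_le_mul_of_nonneg_left h2 hl₂)
    refine h3.trans_eq ?_
    ring
  · have h1 : ∀ i, partialDeriv i (fun y => carlemanWeight ρ y ^ (1 - α) • f y) y = 0 := fun i =>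
      image_eq_zero_of_notMem_tsupport fun h => hy (hsub (tsupport_partialDeriv_subset _ i h))
    have h2 : ∀ i, partialDeriv i f y = 0 := fun i =>
      image_eq_zero_of_notMem_tsupport fun h => hy (tsupport_partialDeriv_subset f i h)
    have h3 : f y = 0 := image_eq_zero_of_notMem_tsupport hy
    simp only [h1, h2, h3]
    simp

/-- `V` may be unbounded, so `L²` convergence of the approximants says nothing directly about the
potential term. Fatou along an almost-everywhere convergent sequence gives its finiteness and its
bound together. -/
theorem integral_weighted_potential_le {V : EuclideanSpace ℝ (Fin d) → ℝ} (hV : Admissible V)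
    {l₁ l₂ : ℝ} (hl₁ : 0 ≤ l₁) (hl₂ : 0 ≤ l₂) (hfb : FormBound V l₁ l₂) {ρ : ℝ} (hρ : 0 < ρ)
    {α : ℝ} (hα : 1 ≤ α) {f : EuclideanSpace ℝ (Fin (d + 1)) → ℂ} (hf : MemH 2 f)
    (hs : tsupport f ⊆ Metric.ball 0 ρ \ {0}) :
    (Integrable fun y => carlemanWeight ρ y ^ (2 - 2 * α)
        * ‖(extendPotential V y : ℂ) * f y‖ ^ 2) ∧
    ∫ y, carlemanWeight ρ y ^ (2 - 2 * α) * ‖(extendPotential V y : ℂ) * f y‖ ^ 2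
      ≤ 2 * l₁ * (∫ y, carlemanWeight ρ y ^ (1 - 2 * α) * weakGradSq f y)
        + (2 * l₁ * α ^ 2 / ρ ^ 2 + l₂)
          * ∫ y, carlemanWeight ρ y ^ (-1 - 2 * α) * ‖f y‖ ^ 2 := by
  obtain ⟨u, hu, hus, hae, h0, h1, -⟩ := exists_weighted_smooth_approximation hρ hf hs
  have hlim := ((h1 (1 - 2 * α)).2.2.const_mul (2 * l₁)).add
    ((h0 (-1 - 2 * α)).2.2.const_mul (2 * l₁ * α ^ 2 / ρ ^ 2 + l₂))
  have hVm : AEMeasurable (fun y => (extendPotential V y : ℂ)) volume :=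
    Complex.measurable_ofReal.comp_aemeasurable (aemeasurable_extendPotential hV.1)
  have hbd := fun k => lintegral_weighted_potential_le hV hl₁ hl₂ hfb hρ hα (hu k) (hus k)
    ((h1 (1 - 2 * α)).1 k) ((h0 (-1 - 2 * α)).1 k)
  have hsm : ∀ k, Continuous fun y => carlemanWeight ρ y ^ (1 - α) • u k y := fun k =>
    (contDiff_carlemanWeight_rpow_mul hρ (1 - α) (hu k) fun h => (hus k h).2 rfl).continuous
  have hmain : ∫⁻ y, ‖(extendPotential V y : ℂ) * (carlemanWeight ρ y ^ (1 - α) • f y)‖ₑ ^ 2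
      ≤ ENNReal.ofReal (2 * l₁ * (∫ y, carlemanWeight ρ y ^ (1 - 2 * α) * weakGradSq f y)
        + (2 * l₁ * α ^ 2 / ρ ^ 2 + l₂)
          * ∫ y, carlemanWeight ρ y ^ (-1 - 2 * α) * ‖f y‖ ^ 2) := by
    calc _ = ∫⁻ y, liminf (fun k => ‖(extendPotential V y : ℂ)
            * (carlemanWeight ρ y ^ (1 - α) • u k y)‖ₑ ^ 2) atTop := by
          refine lintegral_congr_ae (hae.mono fun y hy => ?_)
          have h2 : Tendsto (fun k => (extendPotential V y : ℂ)
              * (carlemanWeight ρ y ^ (1 - α) • u k y)) atTop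
              (𝓝 ((extendPotential V y : ℂ) * (carlemanWeight ρ y ^ (1 - α) • f y))) :=
            (hy.const_smul _).const_mul _
          exact ((ENNReal.continuous_pow 2).tendsto _ |>.comp h2.enorm).liminf_eq.symm
      _ ≤ _ := lintegral_liminf_le' fun k =>
        (hVm.mul (hsm k).aemeasurable).enorm.pow_const 2
      _ ≤ _ := (liminf_le_liminf (Eventually.of_forall hbd)).trans_eq
        (ENNReal.tendsto_ofReal hlim).liminf_eq
  have hfm : AEStronglyMeasurable (fun y => (extendPotential V y : ℂ)
      * (carlemanWeight ρ y ^ (1 - α) • f y)) volume := by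
    refine (aemeasurable_of_tendsto_metrizable_ae atTop
      (fun k => hVm.mul (hsm k).aemeasurable) ?_).aestronglyMeasurable
    exact hae.mono fun y hy => (hy.const_smul _).const_mul _
  have hmem := (memLp_two_iff_lintegral hfm).2 (hmain.trans_lt ENNReal.ofReal_lt_top)
  have heq : ∀ᵐ y, ‖(extendPotential V y : ℂ) * (carlemanWeight ρ y ^ (1 - α) • f y)‖ ^ 2
      = carlemanWeight ρ y ^ (2 - 2 * α) * ‖(extendPotential V y : ℂ) * f y‖ ^ 2 := by
    refine ae_of_all _ fun y => ?_
    by_cases hy : y ∈ tsupport f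
    · have hw := carlemanWeight_pos hρ (hs hy).2
      rw [mul_smul_comm, norm_smul, mul_pow, Real.norm_eq_abs, sq_abs, ← Real.rpow_natCast,
        ← Real.rpow_mul hw.le]
      congr 2
      push_cast
      ring
    · simp [image_eq_zero_of_notMem_tsupport hy]
  refine ⟨(hmem.integrable_norm_pow (p := 2) (by simp)).congr heq, ?_⟩
  rw [← integral_congr_ae heq, integral_norm_sq_eq_toReal hfm]
  refine ENNReal.toReal_le_of_le_ofReal ?_ hmain
  have hnn : ∀ p : ℝ, ∀ y : EuclideanSpace ℝ (Fin (d + 1)), 0 ≤ carlemanWeight ρ y ^ p := fun p y =>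
    Real.rpow_nonneg (mul_nonneg (by positivity) (Real.exp_pos _).le) _
  have i1 : 0 ≤ ∫ y, carlemanWeight ρ y ^ (1 - 2 * α) * weakGradSq f y :=
    integral_nonneg fun y => mul_nonneg (hnn _ y) (Finset.sum_nonneg fun i _ => sq_nonneg _)
  have i2 : 0 ≤ ∫ y, carlemanWeight ρ y ^ (-1 - 2 * α) * ‖f y‖ ^ 2 :=
    integral_nonneg fun y => mul_nonneg (hnn _ y) (sq_nonneg _)
  positivity

/-- With `A = 8Cl₁ρ²` and `b³ = 4Cl₂ρ⁴`, the condition `α ≥ A + b` gives `Aα² + b³ ≤ (A + b)α² ≤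
α³`. This explains the cube root in the threshold. -/
theorem absorption_bound {a C l₁ l₂ ρ α : ℝ} (hC : 0 ≤ C) (hl₁ : 0 ≤ l₁) (hl₂ : 0 ≤ l₂)
    (hα : max a (8 * C * l₁ * ρ ^ 2 + (4 * C * l₂ * ρ ^ 4) ^ ((1 : ℝ) / 3)) ≤ α) :
    8 * C * l₁ * ρ ^ 2 ≤ α ∧ 8 * C * l₁ * ρ ^ 2 * α ^ 2 + 4 * C * l₂ * ρ ^ 4 ≤ α ^ 3 := by
  have h := (le_max_right _ _).trans hα
  have hx : 0 ≤ 4 * C * l₂ * ρ ^ 4 := by positivity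
  have hA : 0 ≤ 8 * C * l₁ * ρ ^ 2 := by positivity
  have hb : ((4 * C * l₂ * ρ ^ 4) ^ ((1 : ℝ) / 3)) ^ 3 = 4 * C * l₂ * ρ ^ 4 := by
    rw [← Real.rpow_natCast, ← Real.rpow_mul hx]
    norm_num
  have hb0 : 0 ≤ (4 * C * l₂ * ρ ^ 4) ^ ((1 : ℝ) / 3) := Real.rpow_nonneg hx _
  generalize (4 * C * l₂ * ρ ^ 4) ^ ((1 : ℝ) / 3) = b at *
  generalize 8 * C * l₁ * ρ ^ 2 = A at *
  refine ⟨by linarith, ?_⟩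
  rw [← hb]
  have h1 : b ^ 2 ≤ α ^ 2 := pow_le_pow_left₀ hb0 (by linarith) 2
  calc A * α ^ 2 + b ^ 3 = A * α ^ 2 + b * b ^ 2 := by ring
    _ ≤ A * α ^ 2 + b * α ^ 2 := by gcongr
    _ = (A + b) * α ^ 2 := by ring
    _ ≤ α * α ^ 2 := by gcongr
    _ = _ := by ring

theorem CarlemanEstimate.add_potential {V : EuclideanSpace ℝ (Fin d) → ℝ} (hV : Admissible V)
    {ρ : ℝ} (hρ : 0 < ρ) {a C l₁ l₂ : ℝ} (ha : 1 ≤ a) (hC : 1 ≤ C)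
    (hCE : CarlemanEstimate ρ (fun _ : EuclideanSpace ℝ (Fin d) => (0 : ℝ)) a C)
    (hl₁ : 0 ≤ l₁) (hl₂ : 0 ≤ l₂) (hfb : FormBound V l₁ l₂) :
    CarlemanEstimate ρ V
      (max a (8 * C * l₁ * ρ ^ 2 + (4 * C * l₂ * ρ ^ 4) ^ ((1 : ℝ) / 3))) (4 * C) := by
  intro α hα f hf hs
  have haα : a ≤ α := (le_max_left _ _).trans hα
  have hα1 : 1 ≤ α := ha.trans haα
  obtain ⟨hc1, hc2⟩ := absorption_bound (by linarith) hl₁ hl₂ hα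
  obtain ⟨hLi, hli, hle⟩ := hCE α haα f hf hs
  obtain ⟨hVi, hVle⟩ := integral_weighted_potential_le hV hl₁ hl₂ hfb hρ hα1 hf hs
  obtain ⟨u, -, -, -, h0, h1, h2⟩ := exists_weighted_smooth_approximation hρ hf hs
  have hL := (integral_carleman_left (c₁ := α * ρ ^ 2) (c₂ := α ^ 3)
    (h1 (1 - 2 * α)).2.1 (h0 (-1 - 2 * α)).2.1).2
  have hsch : ∀ y, ‖schrodinger (fun _ : EuclideanSpace ℝ (Fin d) => (0 : ℝ)) f y‖
      = ‖weakLaplacian f y‖ := fun y => by simp [schrodinger, extendPotential]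
  simp only [hsch] at hli hle
  have hnn : ∀ p : ℝ, ∀ y : EuclideanSpace ℝ (Fin (d + 1)), 0 ≤ carlemanWeight ρ y ^ p := fun p y =>
    Real.rpow_nonneg (mul_nonneg (by positivity) (Real.exp_pos _).le) _
  have hwm : AEMeasurable (fun y : EuclideanSpace ℝ (Fin (d + 1)) =>
      carlemanWeight ρ y ^ (2 - 2 * α)) volume := by
    have hcont : ContinuousOn (fun y : EuclideanSpace ℝ (Fin (d + 1)) =>
        carlemanWeight ρ y ^ (2 - 2 * α)) {0}ᶜ := fun y hy =>
      (contDiffAt_carlemanWeight_rpow hρ _ hy).continuousAt.continuousWithinAt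
    -- The weight is only known to be continuous off the origin, which is a null set.
    rw [← Measure.restrict_eq_self_of_ae_mem (μ := volume)
      (s := ({0}ᶜ : Set (EuclideanSpace ℝ (Fin (d + 1))))) (measure_eq_zero_iff_ae_notMem.1
        (measure_singleton 0))]
    exact hcont.aemeasurable (measurableSet_singleton 0).compl
  have hVm : AEMeasurable (fun y => (extendPotential V y : ℂ)) volume :=
    Complex.measurable_ofReal.comp_aemeasurable (aemeasurable_extendPotential hV.1)
  have hsm : AEMeasurable (schrodinger V f) volume :=
    hf.memLp_weakLaplacian.aestronglyMeasurable.aemeasurable.neg.add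
      (hVm.mul hf.memLp.aestronglyMeasurable.aemeasurable)
  have hpt1 : ∀ y, ‖schrodinger V f y‖ ^ 2
      ≤ 2 * ‖weakLaplacian f y‖ ^ 2 + 2 * ‖(extendPotential V y : ℂ) * f y‖ ^ 2 := fun y => by
    have h := pow_le_pow_left₀ (norm_nonneg _)
      (norm_add_le (-weakLaplacian f y) ((extendPotential V y : ℂ) * f y)) 2
    rw [norm_neg] at h
    simp only [schrodinger]
    nlinarith [sq_nonneg (‖weakLaplacian f y‖ - ‖(extendPotential V y : ℂ) * f y‖)]
  have hpt2 : ∀ y, ‖weakLaplacian f y‖ ^ 2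
      ≤ 2 * ‖schrodinger V f y‖ ^ 2 + 2 * ‖(extendPotential V y : ℂ) * f y‖ ^ 2 := fun y => by
    have h : ‖weakLaplacian f y‖ ≤ ‖schrodinger V f y‖ + ‖(extendPotential V y : ℂ) * f y‖ := by
      have h := norm_sub_le ((extendPotential V y : ℂ) * f y) (schrodinger V f y)
      have e : (extendPotential V y : ℂ) * f y - schrodinger V f y = weakLaplacian f y := by
        simp [schrodinger]
      rw [e] at h
      linarith
    have h' := pow_le_pow_left₀ (norm_nonneg _) h 2
    nlinarith [sq_nonneg (‖schrodinger V f y‖ - ‖(extendPotential V y : ℂ) * f y‖)]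
  have hSi : Integrable (fun y => carlemanWeight ρ y ^ (2 - 2 * α) * ‖schrodinger V f y‖ ^ 2) := by
    refine ((hli.const_mul 2).add (hVi.const_mul 2)).mono'
      (hwm.mul (hsm.norm.pow_const 2)).aestronglyMeasurable (ae_of_all _ fun y => ?_)
    rw [Real.norm_of_nonneg (mul_nonneg (hnn _ y) (sq_nonneg _))]
    refine (mul_le_mul_of_nonneg_left (hpt1 y) (hnn _ y)).trans_eq ?_
    simp only [Pi.add_apply]
    ring
  refine ⟨hLi, hSi, ?_⟩
  have hlap : ∫ y, carlemanWeight ρ y ^ (2 - 2 * α) * ‖weakLaplacian f y‖ ^ 2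
      ≤ 2 * (∫ y, carlemanWeight ρ y ^ (2 - 2 * α) * ‖schrodinger V f y‖ ^ 2)
        + 2 * ∫ y, carlemanWeight ρ y ^ (2 - 2 * α) * ‖(extendPotential V y : ℂ) * f y‖ ^ 2 := by
    rw [← integral_const_mul, ← integral_const_mul,
      ← integral_add (hSi.const_mul 2) (hVi.const_mul 2)]
    refine integral_mono hli ((hSi.const_mul 2).add (hVi.const_mul 2)) fun y => ?_
    refine (mul_le_mul_of_nonneg_left (hpt2 y) (hnn _ y)).trans_eq ?_
    ring
  have i1 : 0 ≤ ∫ y, carlemanWeight ρ y ^ (1 - 2 * α) * weakGradSq f y :=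
    integral_nonneg fun y => mul_nonneg (hnn _ y) (Finset.sum_nonneg fun i _ => sq_nonneg _)
  have i2 : 0 ≤ ∫ y, carlemanWeight ρ y ^ (-1 - 2 * α) * ‖f y‖ ^ 2 :=
    integral_nonneg fun y => mul_nonneg (hnn _ y) (sq_nonneg _)
  rw [hL] at hle ⊢
  generalize ∫ y, carlemanWeight ρ y ^ (1 - 2 * α) * weakGradSq f y = G at *
  generalize ∫ y, carlemanWeight ρ y ^ (-1 - 2 * α) * ‖f y‖ ^ 2 = F at *
  generalize ∫ y, carlemanWeight ρ y ^ (2 - 2 * α) * ‖schrodinger V f y‖ ^ 2 = S at *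
  generalize ∫ y, carlemanWeight ρ y ^ (2 - 2 * α) * ‖weakLaplacian f y‖ ^ 2 = L at *
  generalize ∫ y, carlemanWeight ρ y ^ (2 - 2 * α) * ‖(extendPotential V y : ℂ) * f y‖ ^ 2
    = W at *
  have hCρ : 0 ≤ C * ρ ^ 4 := by positivity
  -- After the potential bound is inserted, the right-hand side is `2Cρ⁴S` plus an expression that
  -- `absorption_bound` makes at most half of the left-hand side. Moving it across doubles `2C` to
  -- `4C`.
  have s1 : α * ρ ^ 2 * G + α ^ 3 * F ≤ C * ρ ^ 4 * (2 * S + 2 * (2 * l₁ * G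
      + (2 * l₁ * α ^ 2 / ρ ^ 2 + l₂) * F)) := hle.trans (by gcongr; linarith)
  have s2 : C * ρ ^ 4 * (2 * S + 2 * (2 * l₁ * G + (2 * l₁ * α ^ 2 / ρ ^ 2 + l₂) * F))
      = 2 * C * ρ ^ 4 * S + 1 / 2 * (ρ ^ 2 * (8 * C * l₁ * ρ ^ 2) * G
        + (8 * C * l₁ * ρ ^ 2 * α ^ 2 + 4 * C * l₂ * ρ ^ 4) * F) := by
    field_simp
    ring
  have s3 : ρ ^ 2 * (8 * C * l₁ * ρ ^ 2) * G ≤ ρ ^ 2 * α * G := by gcongr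
  have s4 : (8 * C * l₁ * ρ ^ 2 * α ^ 2 + 4 * C * l₂ * ρ ^ 4) * F ≤ α ^ 3 * F := by gcongr
  rw [s2] at s1
  linarith

end Potential

theorem theorem5p1 (d : ℕ) (hd : 1 ≤ d) :
    (∃ a C : ℝ, 1 ≤ a ∧ 1 ≤ C ∧
      ∀ ρ : ℝ, 0 < ρ → CarlemanEstimate ρ (fun _ : EuclideanSpace ℝ (Fin d) => (0 : ℝ)) a C) ∧
    ∀ V : EuclideanSpace ℝ (Fin d) → ℝ, Admissible V →
      (∃ l₁ l₂ : ℝ, 0 ≤ l₁ ∧ 0 ≤ l₂ ∧ FormBound V l₁ l₂) ∧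
      ∀ ρ : ℝ, 0 < ρ →
        (∃ α₀ C₀ : ℝ, 1 ≤ α₀ ∧ 1 ≤ C₀ ∧ CarlemanEstimate ρ V α₀ C₀) ∧
        ∀ a C l₁ l₂ : ℝ, 1 ≤ a → 1 ≤ C →
          CarlemanEstimate ρ (fun _ : EuclideanSpace ℝ (Fin d) => (0 : ℝ)) a C →
          0 ≤ l₁ → 0 ≤ l₂ → FormBound V l₁ l₂ →
          CarlemanEstimate ρ V
            (max a (8 * C * l₁ * ρ ^ 2 + (4 * C * l₂ * ρ ^ 4) ^ ((1 : ℝ) / 3))) (4 * C) := by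
  have ha : (1 : ℝ) ≤ 10 * (d + 1) := by linarith [Nat.cast_nonneg (α := ℝ) d]
  have hC : (1 : ℝ) ≤ 900 := by norm_num
  refine ⟨⟨10 * (d + 1), 900, ha, hC, fun ρ hρ => carlemanEstimate_zero hρ⟩, fun V hV => ?_⟩
  obtain ⟨l₁, l₂, hl₁, hl₂, hfb⟩ := hV.exists_formBound
  refine ⟨⟨l₁, l₂, hl₁, hl₂, hfb⟩, fun ρ hρ => ⟨⟨_, _, ha.trans (le_max_left _ _), ?_,
    CarlemanEstimate.add_potential hV hρ ha hC (carlemanEstimate_zero hρ) hl₁ hl₂ hfb⟩,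
    fun a C l₁ l₂ ha hC hCE hl₁ hl₂ hfb =>
      CarlemanEstimate.add_potential hV hρ ha hC hCE hl₁ hl₂ hfb⟩⟩
  norm_num
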